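/- Let $n\ge 2$ and let $\mathbf a=(a_1,\dots,a_n)\in(\mathbb Z_{\ge 0})^n$. The Tesler polytope $\mathsf{Tes}_n(\mathbf a)$ is the set of $n\times n$ upper triangular matrices $(x_{i,j})$ with nonnegative real entries such that $$x_{k,k}+\sum_{j=k+1}^{n}x_{k,j}-\sum_{i=1}^{k-1}x_{i,k}=a_k\qquad(1\le k\le n).$$ The signature $\epsilon(\mathbf a)\in\{0,+\}^n$ records which entries of $\mathbf a$ are zero and which are positive. Assume that $\epsilon(\mathbf a)$ has one of the forms $+0+^{n-2}$, or $+0+^{n-3}0$ with $n\ge 3$. Let $\Delta_d=\{x\in\mathbb R^{d+1}: x_1+\dots+x_{d+1}=1,\ x_i\ge 0\}$. Let $P=(\Delta_{n-2}\times\Delta_{n-1})/\!\sim$, where $(p,q)\sim(p',q)$ for all $p,p'\in\Delta_{n-2}$ whenever $q\in\Delta_{n-1}$ lies on the facet $x_2=0$ of $\Delta_{n-1}$ (and no other distinct points are identified). The faces of $P$ are the images of the nonempty faces of $\Delta_{n-2}\times\Delta_{n-1}$ under the quotient map, and the faces of a product $C\times P$, with $C$ a polytope, are the products of a nonempty face of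 $C$ and a face of $P$. Face posets consist of the nonempty faces, ordered by inclusion. Then: 1. The face poset of $\mathsf{Tes}_n(\mathbf a)$ is isomorphic to the face poset of $\Delta_1\times\Delta_2\times\cdots\times\Delta_{n-3}\times P$ (the product of the simplices $\Delta_1,\dots,\Delta_{n-3}$ is a single point if $n\le 3$). 2. $\mathsf{Tes}_n(\mathbf a)$ has exactly $2\,(n-1)!$ vertices. 3. $\mathsf{Tes}_n(\mathbf a)$ is simple (each vertex lies on exactly $\dim \mathsf{Tes}_n(\mathbf a)$ edges), and its $h$-polynomial is $$\sum_{i}f_i\,(x-1)^i=(1+x^{n-1})\,[n-1]!_x,\qquad [m]!_x=\prod_{i=1}^{m}(1+x+\dots+x^{i-1}),$$ where $f_i$ is the number of $i$-dimensional faces of $\mathsf{Tes}_n(\mathbf a)$. -/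

import Mathlib

namespace Tesler

noncomputable section

/-! Faces, `f`-polynomial and `h`-polynomial of a polytope -/

/-- A (nonempty) face of the polytope `C`: the nonempty set of maximizers over `C` of some
linear functional (the zero functional gives `C` itself). -/
def IsFace {E : Type*} [AddCommGroup E] [Module ℝ E] [TopologicalSpace E]
    (C F : Set E) : Prop :=
  F.Nonempty ∧ IsExposed ℝ C F

/-- The face poset of `C`: its nonempty faces, ordered by inclusion. -/
abbrev FacePoset {E : Type*} [AddCommGroup E] [Module ℝ E] [TopologicalSpace E]
    (C : Set E) : Type _ :=
  {F : Set E // IsFace C F}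

/-- The dimension of the affine hull. -/
def dim {E : Type*} [AddCommGroup E] [Module ℝ E] (F : Set E) : ℕ :=
  Module.finrank ℝ (vectorSpan ℝ F)

/-- The number of `i`-dimensional faces. -/
def fVector {E : Type*} [AddCommGroup E] [Module ℝ E] [TopologicalSpace E]
    (C : Set E) (i : ℕ) : ℕ :=
  {F : Set E | IsFace C F ∧ dim F = i}.ncard

/-- The `f`-polynomial `∑ f_i x^i`, the sum over `0 ≤ i ≤ dim C`. -/
def fPolynomial {E : Type*} [AddCommGroup E] [Module ℝ E] [TopologicalSpace E]
    (C : Set E) : Polynomial ℤ :=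
  ∑ i ∈ Finset.range (dim C + 1), Polynomial.C (fVector C i : ℤ) * Polynomial.X ^ i

/-- The `h`-polynomial `∑ f_i (x - 1)^i`. -/
def hPolynomial {E : Type*} [AddCommGroup E] [Module ℝ E] [TopologicalSpace E]
    (C : Set E) : Polynomial ℤ :=
  (fPolynomial C).comp (Polynomial.X - 1)

/-- A polytope is simple if each of its vertices lies on exactly `dim C` edges. -/
def IsSimple {E : Type*} [AddCommGroup E] [Module ℝ E] [TopologicalSpace E]
    (C : Set E) : Prop :=
  ∀ v ∈ C.extremePoints ℝ, {F : Set E | IsFace C F ∧ dim F = 1 ∧ v ∈ F}.ncard = dim C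

/-- `[m]!_x = ∏_{i=1}^m (1 + x + ⋯ + x^{i-1})`. -/
def qFactorial (m : ℕ) : Polynomial ℤ :=
  ∏ i ∈ Finset.Icc 1 m, ∑ j ∈ Finset.range i, Polynomial.X ^ j

/-! The Tesler polytope -/

/-- The `k`-th hook sum of a square matrix. -/
def hookSum {n : ℕ} (M : Matrix (Fin n) (Fin n) ℝ) (k : Fin n) : ℝ :=
  M k k + ∑ j ∈ Finset.Ioi k, M k j - ∑ i ∈ Finset.Iio k, M i k

/-- The Tesler polytope `Tes_n(a)`: the upper triangular matrices with nonnegative real entries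
whose `k`-th hook sum is `a_k` for all `k`. -/
def Tes {n : ℕ} (a : Fin n → ℕ) : Set (Matrix (Fin n) (Fin n) ℝ) :=
  {M | (∀ i j, j < i → M i j = 0) ∧ (∀ i j, 0 ≤ M i j) ∧ ∀ k, hookSum M k = a k}

/-- The signature of `a`, written as a word in the letters `1` (for `+`) and `0`. -/
def signature {n : ℕ} (a : Fin n → ℕ) : List SignType :=
  List.ofFn fun i => SignType.sign (a i)

/-! The comparison polytope -/

/-- The product `Δ_1 × Δ_2 × ⋯ × Δ_m` of standard simplices, `Δ_d ⊆ ℝ^{d+1}`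
(a single point for `m = 0`); the index `k : Fin m` carries the factor `Δ_{k+1}`. -/
def simplexProduct (m : ℕ) : Set ((k : Fin m) → Fin ((k : ℕ) + 2) → ℝ) :=
  Set.univ.pi fun k => stdSimplex ℝ (Fin ((k : ℕ) + 2))

/-- The polytope `Δ_m × Δ_{m+1}`, with `Δ_d ⊆ ℝ^{d+1}`. -/
def twoSimplices (m : ℕ) : Set ((Fin (m + 1) → ℝ) × (Fin (m + 2) → ℝ)) :=
  stdSimplex ℝ (Fin (m + 1)) ×ˢ stdSimplex ℝ (Fin (m + 2))

/-- The equivalence relation on `Δ_m × Δ_{m+1}` with `(p, q) ∼ (p', q)` for all `p`, `p'` whenever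
the second coordinate of `q` (the one with index `1`, counting from `0`) vanishes. -/
def collapse (m : ℕ) : Setoid (twoSimplices m) where
  r x y := x = y ∨ (x.1.2 = y.1.2 ∧ x.1.2 1 = 0)
  iseqv :=
    { refl := fun _ => Or.inl rfl
      symm := by
        rintro x y (h | ⟨h, h0⟩)
        · exact Or.inl h.symm
        · exact Or.inr ⟨h.symm, h ▸ h0⟩
      trans := by
        rintro x y z (rfl | ⟨h, h0⟩) (rfl | ⟨h', h0'⟩)
        · exact Or.inl rfl
        · exact Or.inr ⟨h', h0'⟩
        · exact Or.inr ⟨h, h0⟩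
        · exact Or.inr ⟨h.trans h', h0⟩ }

/-- The quotient `P = (Δ_m × Δ_{m+1}) / ∼`. -/
def QuotientPolytope (m : ℕ) : Type :=
  Quotient (collapse m)

/-- The quotient map `Δ_m × Δ_{m+1} → P`. -/
def quotientMap (m : ℕ) : twoSimplices m → QuotientPolytope m :=
  Quotient.mk (collapse m)

/-- The faces of `P`: the images under the quotient map of the faces of `Δ_m × Δ_{m+1}`. -/
def IsQuotientFace (m : ℕ) (G : Set (QuotientPolytope m)) : Prop :=
  ∃ F, IsFace (twoSimplices m) F ∧ G = quotientMap m '' (Subtype.val ⁻¹' F)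

/-- The face poset of `C × P`, for a polytope `C`: the products of a face of `C` and a face
of `P`, ordered by inclusion. -/
abbrev ProductFacePoset {E : Type*} [AddCommGroup E] [Module ℝ E] [TopologicalSpace E]
    (C : Set E) (m : ℕ) : Type _ :=
  {H : Set (E × QuotientPolytope m) // ∃ A B, IsFace C A ∧ IsQuotientFace m B ∧ H = A ×ˢ B}

end

end Tesler

/-! A Tesler polytope is cut out of an affine space by the inequalities `0 ≤ M i j`, so its nonempty
faces correspond to the supports of its points (`isFace_iff`). Read a matrix as a flow: row `r`
receives `a r` plus the entries above the diagonal in column `r`, and spreads this total over the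
columns `j ≥ r`. Hence row sets `S r ⊆ {r, r+1, …}` form a support exactly when `S r` is nonempty
precisely for those `r` with `0 < a r` or `r ∈ S i` for some `i < r`. Sufficiency comes from
spreading each row total uniformly (`solveHook`). Rank-nullity gives the face the dimension `∑ (|S
r| - 1)` over its nonempty rows (`dim_teslerFaceIso`).

Write `n = m + 2` and count rows from `0`. For the signatures considered, row `0` is any nonempty
set `B`; row `1` is a set `A` that is nonempty iff `1 ∈ B`; rows `2, …, m` are arbitrary nonempty
sets. For `m ≥ 1` the last row has only its diagonal position, and the earlier rows together with
`a` decide whether it is used. The data left over is a `Pattern`. Patterns also label the faces of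
the product polytope: a face of `P` with vertex sets `A`, `B` forgets `A` exactly when `1 ∉ B`,
since then it lies over the collapsed facet. This gives the isomorphism.

The rest is counting patterns by rank. Substituting `y = X - 1` in `∑ y ^ rank` gives the
`h`-polynomial (`sum_pattern_X_sub_one`), whose value at `1` is the number of vertices. Above a
pattern of rank `0` the same sum is `(y + 1) ^ dim` (`sum_pattern_ge`), and its linear coefficient
counts the edges at a vertex. -/

namespace Tesler

/-! ### Faces of a polyhedron given by coordinate inequalities -/

section CoordPolyhedron

variable {E : Type*} [AddCommGroup E] [Module ℝ E] [TopologicalSpace E] {ι : Type*}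

/-- The polyhedron `C` is cut out of an affine subspace with direction `L` by the inequalities
`0 ≤ φ i x`. -/
structure IsCoordPolyhedron (C : Set E) (φ : ι → E →L[ℝ] ℝ) (L : Submodule ℝ E) : Prop where
  nonneg : ∀ x ∈ C, ∀ i, 0 ≤ φ i x
  sub_mem : ∀ x ∈ C, ∀ y ∈ C, y - x ∈ L
  add_mem : ∀ x ∈ C, ∀ v ∈ L, (∀ i, 0 ≤ φ i (x + v)) → x + v ∈ C

/-- The indices of the nonzero coordinates. -/
def coordSupport (φ : ι → E →L[ℝ] ℝ) (x : E) : Set ι := {i | φ i x ≠ 0}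

/-- The points of `C` whose coordinates outside `S` vanish. -/
def coordFace (C : Set E) (φ : ι → E →L[ℝ] ℝ) (S : Set ι) : Set E :=
  {x | x ∈ C ∧ ∀ i ∉ S, φ i x = 0}

theorem mem_coordFace_iff {C : Set E} {φ : ι → E →L[ℝ] ℝ} {S : Set ι} {x : E} :
    x ∈ coordFace C φ S ↔ x ∈ C ∧ coordSupport φ x ⊆ S := by
  simp only [coordFace, coordSupport, Set.mem_ofPred_eq, Set.subset_def]
  refine and_congr_right fun _ => forall_congr' fun i => ?_
  tauto

theorem coordFace_support_subset_iff {C : Set E} {φ : ι → E →L[ℝ] ℝ} {T : Set ι} {x : E}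
    (hx : x ∈ C) :
    coordFace C φ (coordSupport φ x) ⊆ coordFace C φ T ↔ coordSupport φ x ⊆ T := by
  constructor
  · intro h
    exact (mem_coordFace_iff.1 (h (mem_coordFace_iff.2 ⟨hx, subset_rfl⟩))).2
  · intro h y hy
    rw [mem_coordFace_iff] at hy ⊢
    exact ⟨hy.1, hy.2.trans h⟩

namespace IsCoordPolyhedron

variable {C : Set E} {φ : ι → E →L[ℝ] ℝ} {L : Submodule ℝ E}

theorem convex (hC : IsCoordPolyhedron C φ L) : Convex ℝ C := by
  intro x hx y hy s t hs ht hst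
  have h : s • x + t • y = x + t • (y - x) := by
    rw [← eq_sub_iff_add_eq] at hst
    subst hst
    module
  rw [h]
  refine hC.add_mem x hx _ (L.smul_mem t (hC.sub_mem x hx y hy)) fun i => ?_
  rw [← h, map_add, map_smul, map_smul]
  exact add_nonneg (mul_nonneg hs (hC.nonneg x hx i)) (mul_nonneg ht (hC.nonneg y hy i))

/-- The finitely many positive coordinates stay positive for small `t`, and the zero coordinates do
not move. -/
theorem exists_add_smul_mem [Finite ι] (hC : IsCoordPolyhedron C φ L) {x v : E} (hx : x ∈ C)
    (hv : v ∈ L) (hxv : ∀ i ∉ coordSupport φ x, φ i v = 0) :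
    ∃ t : ℝ, 0 < t ∧ x + t • v ∈ C := by
  have h : ∀ i, ∀ᶠ t : ℝ in nhdsWithin 0 (Set.Ioi 0), 0 ≤ φ i (x + t • v) := by
    intro i
    by_cases hi : i ∈ coordSupport φ x
    · have hpos : 0 < φ i x := lt_of_le_of_ne (hC.nonneg x hx i) (Ne.symm hi)
      have hc : Continuous fun t : ℝ => φ i x + t * φ i v := by fun_prop
      have := (hc.tendsto 0).eventually (lt_mem_nhds (a := 0) (by simpa using hpos))
      filter_upwards [nhdsWithin_le_nhds this] with t ht
      simpa using ht.le
    · refine Filter.Eventually.of_forall fun t => ?_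
      simpa [hxv i hi] using hC.nonneg x hx i
  obtain ⟨t, ht, ht0⟩ := ((Filter.eventually_all.2 h).and self_mem_nhdsWithin).exists
  exact ⟨t, ht0, hC.add_mem x hx _ (L.smul_mem t hv) ht⟩

theorem coordSupport_midpoint (hC : IsCoordPolyhedron C φ L) {x y : E} (hx : x ∈ C)
    (hy : y ∈ C) :
    coordSupport φ ((1 / 2 : ℝ) • x + (1 / 2 : ℝ) • y) = coordSupport φ x ∪ coordSupport φ y := by
  ext i
  have h1 := hC.nonneg x hx i
  have h2 := hC.nonneg y hy i
  simp only [coordSupport, Set.mem_ofPred_eq, Set.mem_union, map_add, map_smul, smul_eq_mul]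
  rw [← not_and_or, not_iff_not]
  constructor
  · intro h
    constructor <;> linarith
  · rintro ⟨h, h'⟩
    rw [h, h']
    ring

/-- Nonnegative coordinates cannot cancel, so a midpoint has the union of the two supports; a
maximal support is therefore the largest. The point found plays the role of a relative interior
point of `F`. -/
theorem exists_support_max [Finite ι] (hC : IsCoordPolyhedron C φ L) {F : Set E} (hF : F ⊆ C)
    (hc : Convex ℝ F) (hne : F.Nonempty) :
    ∃ x ∈ F, ∀ y ∈ F, coordSupport φ y ⊆ coordSupport φ x := by
  obtain ⟨S, hS⟩ := (Set.toFinite (coordSupport φ '' F)).exists_maximal (hne.image _)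
  obtain ⟨x, hx, rfl⟩ := hS.1
  refine ⟨x, hx, fun y hy => ?_⟩
  have hm := hc hx hy (a := 1 / 2) (b := 1 / 2) (by norm_num) (by norm_num) (by norm_num)
  have h := hC.coordSupport_midpoint (hF hx) (hF hy)
  have := hS.2 ⟨_, hm, rfl⟩ (h ▸ Set.subset_union_left)
  rw [h] at this
  exact Set.subset_union_right.trans this

theorem isFace_coordFace [Fintype ι] (hC : IsCoordPolyhedron C φ L) {S : Set ι}
    (hne : (coordFace C φ S).Nonempty) : IsFace C (coordFace C φ S) := by
  classical
  -- This functional is at most `0` on `C`, with equality exactly where all coordinates outside `S`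
  -- vanish.
  refine ⟨hne, fun _ => ⟨-∑ i with i ∉ S, φ i, ?_⟩⟩
  obtain ⟨z, hz⟩ := hne
  have key : ∀ x ∈ C, 0 ≤ ∑ i with i ∉ S, φ i x := fun x hx =>
    Finset.sum_nonneg fun i _ => hC.nonneg x hx i
  have key0 : ∀ x ∈ coordFace C φ S, ∑ i with i ∉ S, φ i x = 0 := fun x hx =>
    Finset.sum_eq_zero fun i hi => hx.2 i (Finset.mem_filter.1 hi).2
  ext x
  simp only [Set.mem_ofPred_eq, neg_apply, sum_apply,
    neg_le_neg_iff]
  constructor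
  · intro hx
    refine ⟨hx.1, fun y hy => ?_⟩
    rw [key0 x hx]
    exact key y hy
  · rintro ⟨hx, h⟩
    refine ⟨hx, fun i hi => ?_⟩
    have h0 := h z hz.1
    rw [key0 z hz] at h0
    exact (Finset.sum_eq_zero_iff_of_nonneg fun i _ => hC.nonneg x hx i).1
      (le_antisymm h0 (key x hx)) i (Finset.mem_filter.2 ⟨Finset.mem_univ _, hi⟩)

theorem isFace_iff [Fintype ι] (hC : IsCoordPolyhedron C φ L) {F : Set E} :
    IsFace C F ↔ ∃ x ∈ C, F = coordFace C φ (coordSupport φ x) := by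
  constructor
  · rintro ⟨hne, hF⟩
    obtain ⟨l, hl⟩ := hF hne
    have hFC : F ⊆ C := fun x hx => (hl ▸ hx : x ∈ {x | x ∈ C ∧ ∀ y ∈ C, l y ≤ l x}).1
    obtain ⟨x, hx, hmax⟩ := hC.exists_support_max hFC (hF.convex hC.convex) hne
    refine ⟨x, hFC hx, Set.Subset.antisymm (fun y hy => ?_) fun y hy => ?_⟩
    · exact mem_coordFace_iff.2 ⟨hFC hy, hmax y hy⟩
    -- The segment from `y` to `x` can be prolonged beyond `x` inside `C`. Since `l` is maximal at
    -- `x`, it cannot increase along it, so `l x ≤ l y`.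
    · obtain ⟨t, ht, htC⟩ := hC.exists_add_smul_mem (hFC hx) (hC.sub_mem y hy.1 x (hFC hx))
        (fun i hi => by
          have h1 : φ i x = 0 := not_not.1 hi
          rw [map_sub, h1, hy.2 i hi, sub_zero])
      rw [hl] at hx ⊢
      have h1 := hx.2 _ htC
      rw [map_add, map_smul, map_sub, smul_eq_mul] at h1
      have h2 : l x ≤ l y := by nlinarith
      exact ⟨hy.1, fun z hz => (hx.2 z hz).trans h2⟩
  · rintro ⟨x, hx, rfl⟩
    exact hC.isFace_coordFace ⟨x, mem_coordFace_iff.2 ⟨hx, subset_rfl⟩⟩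

theorem vectorSpan_coordFace [Finite ι] (hC : IsCoordPolyhedron C φ L) {x : E} (hx : x ∈ C) :
    vectorSpan ℝ (coordFace C φ (coordSupport φ x)) =
      L ⊓ ⨅ i ∈ (coordSupport φ x)ᶜ, LinearMap.ker (φ i : E →ₗ[ℝ] ℝ) := by
  apply le_antisymm
  · rw [vectorSpan, Submodule.span_le]
    rintro _ ⟨y, hy, z, hz, rfl⟩
    refine ⟨hC.sub_mem z hz.1 y hy.1, ?_⟩
    simp only [SetLike.mem_coe, Submodule.mem_iInf, LinearMap.mem_ker]
    intro i hi
    simp [hy.2 i hi, hz.2 i hi]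
  · rintro v ⟨hv, hv'⟩
    simp only [SetLike.mem_coe, Submodule.mem_iInf, LinearMap.mem_ker] at hv'
    have hv' : ∀ i ∉ coordSupport φ x, φ i v = 0 := hv'
    obtain ⟨t, ht, htC⟩ := hC.exists_add_smul_mem hx hv hv'
    have h : (x + t • v) -ᵥ x ∈ vectorSpan ℝ (coordFace C φ (coordSupport φ x)) := by
      refine vsub_mem_vectorSpan ℝ ⟨htC, fun i hi => ?_⟩
        (mem_coordFace_iff.2 ⟨hx, subset_rfl⟩)
      have h1 : φ i x = 0 := not_not.1 hi
      simp [h1, hv' i hi]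
    rw [vsub_eq_sub, add_sub_cancel_left] at h
    exact (Submodule.smul_mem_iff _ ht.ne').1 h

theorem coordFace_eq_singleton [Finite ι] (hC : IsCoordPolyhedron C φ L) {x : E}
    (hx : x ∈ C.extremePoints ℝ) : coordFace C φ (coordSupport φ x) = {x} := by
  refine Set.eq_singleton_iff_unique_mem.2 ⟨mem_coordFace_iff.2 ⟨hx.1, subset_rfl⟩, ?_⟩
  intro y hy
  obtain ⟨t, ht, htC⟩ := hC.exists_add_smul_mem hx.1 (hC.sub_mem y hy.1 x hx.1)
    (fun i hi => by
      have h1 : φ i x = 0 := not_not.1 hi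
      rw [map_sub, h1, hy.2 i hi, sub_zero])
  -- The weights that express `x` through `y` and the point `x + t • (x - y)` beyond it.
  refine hx.2 hy.1 htC ⟨t / (1 + t), 1 / (1 + t), by positivity, by positivity, by field_simp; ring, ?_⟩
  have h1 : (1 + t) ≠ 0 := by positivity
  have : x = (1 / (1 + t)) • ((1 + t) • x) := by
    rw [smul_smul, one_div_mul_cancel h1, one_smul]
  conv_rhs => rw [this]
  rw [div_eq_mul_one_div t, mul_comm t]
  rw [mul_smul, ← smul_add]
  congr 1
  module

end IsCoordPolyhedron

theorem mem_extremePoints_iff_isFace_singleton [Fintype ι] {C : Set E} {φ : ι → E →L[ℝ] ℝ}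
    {L : Submodule ℝ E} (hC : IsCoordPolyhedron C φ L) {x : E} :
    x ∈ C.extremePoints ℝ ↔ IsFace C {x} := by
  constructor
  · intro hx
    exact hC.isFace_iff.2 ⟨x, hx.1, (hC.coordFace_eq_singleton hx).symm⟩
  · intro hx
    exact isExtreme_singleton.1 hx.2.isExtreme

end CoordPolyhedron

theorem dim_singleton {E : Type*} [AddCommGroup E] [Module ℝ E] (x : E) : dim ({x} : Set E) = 0 := by
  simp [dim]

theorem eq_singleton_of_dim_eq_zero {E : Type*} [AddCommGroup E] [Module ℝ E] [Module.Finite ℝ E] {F : Set E} {x : E} (hx : x ∈ F)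
    (h : dim F = 0) : F = {x} := by
  rw [dim, Submodule.finrank_eq_zero, vectorSpan_eq_bot_iff_subsingleton] at h
  exact h.eq_singleton_of_mem hx

theorem dim_mono {E : Type*} [AddCommGroup E] [Module ℝ E] [Module.Finite ℝ E] {F G : Set E} (h : F ⊆ G) : dim F ≤ dim G :=
  Submodule.finrank_mono (vectorSpan_mono ℝ h)

/-! ### Supports of Tesler matrices, their faces and dimensions -/

section TeslerFaces

variable {n : ℕ}

theorem hookSum_add (M N : Matrix (Fin n) (Fin n) ℝ) (k : Fin n) :
    hookSum (M + N) k = hookSum M k + hookSum N k := by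
  simp only [hookSum, Matrix.add_apply, Finset.sum_add_distrib]
  ring

theorem hookSum_smul (c : ℝ) (M : Matrix (Fin n) (Fin n) ℝ) (k : Fin n) :
    hookSum (c • M) k = c * hookSum M k := by
  simp only [hookSum, Matrix.smul_apply, smul_eq_mul, ← Finset.mul_sum]
  ring

/-- The hook sum as a linear map. -/
def hookSumₗ : Matrix (Fin n) (Fin n) ℝ →ₗ[ℝ] Fin n → ℝ where
  toFun M k := hookSum M k
  map_add' M N := funext (hookSum_add M N)
  map_smul' c M := funext (hookSum_smul c M)

theorem hookSum_eq_of_upperTriangular {M : Matrix (Fin n) (Fin n) ℝ}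
    (hM : ∀ i j, j < i → M i j = 0) (k : Fin n) :
    hookSum M k = ∑ j, M k j - ∑ i ∈ Finset.Iio k, M i k := by
  rw [hookSum]
  congr 1
  rw [← Finset.sum_insert (Finset.notMem_Ioi_self), Finset.Ioi_insert]
  exact Finset.sum_subset (Finset.subset_univ _) fun j _ hj => hM k j (by simpa using hj)

/-- The direction of the affine space containing the Tesler polytopes. -/
def teslerDirection (n : ℕ) : Submodule ℝ (Matrix (Fin n) (Fin n) ℝ) where
  carrier := {M | (∀ i j, j < i → M i j = 0) ∧ ∀ k, hookSum M k = 0}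
  add_mem' := by
    rintro M N ⟨h1, h2⟩ ⟨h3, h4⟩
    exact ⟨fun i j hij => by simp [h1 i j hij, h3 i j hij],
      fun k => by rw [hookSum_add, h2, h4, add_zero]⟩
  zero_mem' := ⟨fun _ _ _ => rfl, fun k => by simp [hookSum]⟩
  smul_mem' := by
    rintro c M ⟨h1, h2⟩
    exact ⟨fun i j hij => by simp [h1 i j hij], fun k => by rw [hookSum_smul, h2, mul_zero]⟩

/-- The entries of a matrix as continuous linear functionals. -/
noncomputable def entry (p : Fin n × Fin n) : Matrix (Fin n) (Fin n) ℝ →L[ℝ] ℝ where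
  toFun M := M p.1 p.2
  map_add' _ _ := rfl
  map_smul' _ _ := rfl
  cont := continuous_id.matrix_elem p.1 p.2

theorem entry_apply (p : Fin n × Fin n) (M : Matrix (Fin n) (Fin n) ℝ) :
    entry p M = M p.1 p.2 := rfl

theorem isCoordPolyhedron_Tes (a : Fin n → ℕ) :
    IsCoordPolyhedron (Tes a) entry (teslerDirection n) where
  nonneg M hM p := hM.2.1 p.1 p.2
  sub_mem M hM N hN := by
    refine ⟨fun i j hij => by simp [hM.1 i j hij, hN.1 i j hij], fun k => ?_⟩
    have h := hookSum_add (N - M) M k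
    rw [sub_add_cancel, hN.2.2, hM.2.2] at h
    linarith
  add_mem M hM N hN h := by
    refine ⟨fun i j hij => by simp [hM.1 i j hij, hN.1 i j hij], fun i j => h (i, j), fun k => ?_⟩
    rw [hookSum_add, hM.2.2, hN.2, add_zero]

/-- The supports of the points of the Tesler polytope, described row by row. -/
def IsTeslerSupport (a : Fin n → ℕ) (S : Fin n → Finset (Fin n)) : Prop :=
  (∀ r, S r ⊆ Finset.Ici r) ∧ ∀ r, (S r).Nonempty ↔ 0 < a r ∨ ∃ i < r, r ∈ S i

/-- The row sums of the matrix constructed in `solveHook`. -/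
noncomputable def rowTotal (c : Fin n → ℝ) (w : Fin n → Fin n → ℝ) (r : Fin n) : ℝ :=
  c r + ∑ i : {i // i < r}, rowTotal c w i.1 * w i.1 r
termination_by r
decreasing_by exact i.2

theorem rowTotal_eq (c : Fin n → ℝ) (w : Fin n → Fin n → ℝ) (r : Fin n) :
    rowTotal c w r = c r + ∑ i ∈ Finset.Iio r, rowTotal c w i * w i r := by
  rw [rowTotal]
  congr 1
  exact (Finset.sum_subtype (Finset.Iio r) (fun i => Finset.mem_Iio)
    fun i => rowTotal c w i * w i r).symm

/-- The uniform distribution on each row of `S`. -/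
noncomputable def rowWeight (S : Fin n → Finset (Fin n)) (i j : Fin n) : ℝ :=
  if j ∈ S i then ((S i).card : ℝ)⁻¹ else 0

theorem rowWeight_nonneg (S : Fin n → Finset (Fin n)) (i j : Fin n) : 0 ≤ rowWeight S i j := by
  rw [rowWeight]
  split_ifs <;> positivity

theorem rowWeight_of_notMem {S : Fin n → Finset (Fin n)} {i j : Fin n} (h : j ∉ S i) :
    rowWeight S i j = 0 := if_neg h

theorem rowWeight_pos {S : Fin n → Finset (Fin n)} {i j : Fin n} (h : j ∈ S i) :
    0 < rowWeight S i j := by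
  rw [rowWeight, if_pos h]
  have : 0 < (S i).card := Finset.card_pos.2 ⟨j, h⟩
  positivity

theorem sum_rowWeight {S : Fin n → Finset (Fin n)} {i : Fin n} (h : (S i).Nonempty) :
    ∑ j, rowWeight S i j = 1 := by
  simp only [rowWeight, Finset.sum_ite_mem, Finset.univ_inter, Finset.sum_const, nsmul_eq_mul]
  exact mul_inv_cancel₀ (by exact_mod_cast h.card_pos.ne')

/-- A matrix supported in `S` with hook sums `c` on the nonempty rows of `S`. -/
noncomputable def solveHook (S : Fin n → Finset (Fin n)) (c : Fin n → ℝ) :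
    Matrix (Fin n) (Fin n) ℝ :=
  fun i j => rowTotal c (rowWeight S) i * rowWeight S i j

theorem solveHook_of_notMem {S : Fin n → Finset (Fin n)} (c : Fin n → ℝ) {i j : Fin n}
    (h : j ∉ S i) : solveHook S c i j = 0 := by
  rw [solveHook, rowWeight_of_notMem h, mul_zero]

/-- The weights of a nonempty row add up to `1`, so its row sum is `rowTotal`, and the recursion for
`rowTotal` is the hook equation. The right-hand side `c` may have any sign, which the dimension
count needs. -/
theorem hookSum_solveHook {S : Fin n → Finset (Fin n)} (hS : ∀ r, S r ⊆ Finset.Ici r)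
    (c : Fin n → ℝ) {r : Fin n} (hr : (S r).Nonempty) : hookSum (solveHook S c) r = c r := by
  rw [hookSum_eq_of_upperTriangular]
  · simp only [solveHook]
    rw [← Finset.mul_sum, sum_rowWeight hr, mul_one, rowTotal_eq]
    ring
  · intro i j hij
    exact solveHook_of_notMem c fun h => hij.not_ge (Finset.mem_Ici.1 (hS i h))

theorem hookSum_eq_zero_of_row_col {M : Matrix (Fin n) (Fin n) ℝ} {r : Fin n}
    (h1 : ∀ j, M r j = 0) (h2 : ∀ i < r, M i r = 0) : hookSum M r = 0 := by
  rw [hookSum, h1, Finset.sum_eq_zero fun j _ => h1 j,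
    Finset.sum_eq_zero fun i hi => h2 i (Finset.mem_Iio.1 hi)]
  norm_num

theorem rowTotal_nonneg {c : Fin n → ℝ} (hc : ∀ r, 0 ≤ c r) (S : Fin n → Finset (Fin n))
    (r : Fin n) : 0 ≤ rowTotal c (rowWeight S) r := by
  induction r using WellFoundedLT.induction with
  | ind r ih =>
    rw [rowTotal_eq]
    exact add_nonneg (hc r) (Finset.sum_nonneg fun i hi =>
      mul_nonneg (ih i (Finset.mem_Iio.1 hi)) (rowWeight_nonneg _ _ _))

theorem rowTotal_pos {a : Fin n → ℕ} {S : Fin n → Finset (Fin n)} (hS : IsTeslerSupport a S)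
    (r : Fin n) (hr : (S r).Nonempty) : 0 < rowTotal (fun k => (a k : ℝ)) (rowWeight S) r := by
  induction r using WellFoundedLT.induction with
  | ind r ih =>
    have hnn : ∀ i, 0 ≤ rowTotal (fun k => (a k : ℝ)) (rowWeight S) i * rowWeight S i r :=
      fun i => mul_nonneg (rowTotal_nonneg (fun k => Nat.cast_nonneg _) _ _)
        (rowWeight_nonneg _ _ _)
    rw [rowTotal_eq]
    rcases (hS.2 r).1 hr with h | ⟨i, hi, hri⟩
    · exact add_pos_of_pos_of_nonneg (by exact_mod_cast h) (Finset.sum_nonneg fun i _ => hnn i)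
    · refine add_pos_of_nonneg_of_pos (Nat.cast_nonneg _)
        (Finset.sum_pos' (fun i _ => hnn i) ⟨i, Finset.mem_Iio.2 hi, ?_⟩)
      exact mul_pos (ih i hi ⟨r, hri⟩) (rowWeight_pos hri)

theorem solveHook_mem_Tes {a : Fin n → ℕ} {S : Fin n → Finset (Fin n)}
    (hS : IsTeslerSupport a S) : solveHook S (fun k => (a k : ℝ)) ∈ Tes a := by
  refine ⟨fun i j hij => ?_, fun i j => ?_, fun k => ?_⟩
  · exact solveHook_of_notMem _ fun h => hij.not_ge (Finset.mem_Ici.1 (hS.1 i h))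
  · exact mul_nonneg (rowTotal_nonneg (fun k => Nat.cast_nonneg _) _ _) (rowWeight_nonneg _ _ _)
  · by_cases hk : (S k).Nonempty
    · exact hookSum_solveHook hS.1 _ hk
    · have h := (not_congr (hS.2 k)).1 hk
      push Not at h
      rw [hookSum_eq_zero_of_row_col]
      · rw [Nat.le_zero.1 h.1, Nat.cast_zero]
      · exact fun j => solveHook_of_notMem _ fun hj => hk ⟨j, hj⟩
      · exact fun i hi => solveHook_of_notMem _ (h.2 i hi)

/-- A family of rows as a set of matrix positions. -/
def positions (S : Fin n → Finset (Fin n)) : Set (Fin n × Fin n) := {p | p.2 ∈ S p.1}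

theorem positions_subset_iff {S T : Fin n → Finset (Fin n)} :
    positions S ⊆ positions T ↔ S ≤ T :=
  ⟨fun h i j hj => h (a := (i, j)) hj, fun h p hp => h p.1 hp⟩

theorem coordSupport_solveHook {a : Fin n → ℕ} {S : Fin n → Finset (Fin n)}
    (hS : IsTeslerSupport a S) :
    coordSupport entry (solveHook S (fun k => (a k : ℝ))) = positions S := by
  ext ⟨i, j⟩
  change solveHook S (fun k => (a k : ℝ)) i j ≠ 0 ↔ j ∈ S i
  constructor
  · exact fun h => by_contra fun hj => h (solveHook_of_notMem _ hj)
  · exact fun h => (mul_pos (rowTotal_pos hS i ⟨j, h⟩) (rowWeight_pos h)).ne'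

/-- The hook equation says that the sum of row `r` is `a r` plus the entries above the diagonal in
column `r`. All terms are nonnegative, so one side is positive iff some term of the other is. -/
theorem exists_isTeslerSupport {a : Fin n → ℕ} {M : Matrix (Fin n) (Fin n) ℝ} (hM : M ∈ Tes a) :
    ∃ S, IsTeslerSupport a S ∧ coordSupport entry M = positions S := by
  classical
  refine ⟨fun i => {j | M i j ≠ 0}, ⟨fun i j hj => ?_, fun r => ?_⟩, ?_⟩
  · rw [Finset.mem_Ici]
    by_contra h
    exact (Finset.mem_filter.1 hj).2 (hM.1 i j (not_le.1 h))
  · have h := hM.2.2 r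
    rw [hookSum_eq_of_upperTriangular hM.1, sub_eq_iff_eq_add] at h
    have hpos : (Finset.univ.filter fun j => M r j ≠ 0).Nonempty ↔ 0 < ∑ j, M r j := by
      rw [Finset.sum_pos_iff_of_nonneg fun j _ => hM.2.1 r j]
      simp only [Finset.Nonempty, Finset.mem_filter, Finset.mem_univ, true_and]
      exact exists_congr fun j => (hM.2.1 r j).lt_iff_ne'.symm
    rw [hpos, h]
    have hnn : 0 ≤ ∑ i ∈ Finset.Iio r, M i r := Finset.sum_nonneg fun i _ => hM.2.1 i r
    have ha : (0 : ℝ) ≤ a r := Nat.cast_nonneg _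
    have : 0 < ∑ i ∈ Finset.Iio r, M i r ↔ ∃ i < r, r ∈ Finset.univ.filter fun j => M i j ≠ 0 := by
      rw [Finset.sum_pos_iff_of_nonneg fun i _ => hM.2.1 i r]
      simp only [Finset.mem_Iio, Finset.mem_filter, Finset.mem_univ, true_and]
      exact exists_congr fun i => and_congr_right fun _ => (hM.2.1 i r).lt_iff_ne'
    rw [← this, ← Nat.cast_pos (α := ℝ)]
    constructor
    · intro h
      by_contra! h'
      linarith
    · rintro (h | h) <;> linarith
  · ext ⟨i, j⟩
    simp [positions, coordSupport, entry_apply]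

/-- The faces of the Tesler polytope correspond to the supports of its points. -/
noncomputable def teslerFaceIso (a : Fin n → ℕ) :
    {S : Fin n → Finset (Fin n) // IsTeslerSupport a S} ≃o FacePoset (Tes a) :=
  RelIso.ofSurjective (OrderEmbedding.ofMapLEIff
    (fun S => ⟨coordFace (Tes a) entry (positions S.1), by
      rw [← coordSupport_solveHook S.2]
      exact (isCoordPolyhedron_Tes a).isFace_iff.2 ⟨_, solveHook_mem_Tes S.2, rfl⟩⟩)
    (fun S T => by
      rw [Subtype.mk_le_mk, ← Subtype.coe_le_coe (y := T), ← positions_subset_iff,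
        ← coordSupport_solveHook S.2]
      exact coordFace_support_subset_iff (solveHook_mem_Tes S.2)))
    (by
      rintro ⟨F, hF⟩
      obtain ⟨M, hM, rfl⟩ := (isCoordPolyhedron_Tes a).isFace_iff.1 hF
      obtain ⟨S, hS, hMS⟩ := exists_isTeslerSupport hM
      exact ⟨⟨S, hS⟩, Subtype.ext (congrArg (coordFace (Tes a) entry) hMS.symm)⟩)

/-- Extension by zero of a function on the positions in `S`. -/
noncomputable def extendPositions (S : Fin n → Finset (Fin n)) :
    ((Σ r, S r) → ℝ) →ₗ[ℝ] Matrix (Fin n) (Fin n) ℝ where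
  toFun f := Matrix.of fun i j => if h : j ∈ S i then f ⟨i, j, h⟩ else 0
  map_add' f g := by
    ext i j
    simp only [Matrix.add_apply, Matrix.of_apply]
    split_ifs
    · rfl
    · exact (add_zero 0).symm
  map_smul' c f := by
    ext i j
    simp only [Matrix.smul_apply, Matrix.of_apply]
    split_ifs
    · rfl
    · exact (smul_zero c).symm

theorem extendPositions_of_mem {S : Fin n → Finset (Fin n)} (f : (Σ r, S r) → ℝ) {i j : Fin n}
    (h : j ∈ S i) : extendPositions S f i j = f ⟨i, j, h⟩ := dif_pos h

theorem extendPositions_of_notMem {S : Fin n → Finset (Fin n)} (f : (Σ r, S r) → ℝ) {i j : Fin n}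
    (h : j ∉ S i) : extendPositions S f i j = 0 := dif_neg h

theorem extendPositions_injective (S : Fin n → Finset (Fin n)) :
    Function.Injective (extendPositions S) := by
  intro f g h
  ext ⟨i, j, hj⟩
  have := congrFun (congrFun h i) j
  rwa [extendPositions_of_mem f hj, extendPositions_of_mem g hj] at this

/-- Rank-nullity for the map `g` from functions on the positions in `S` to hook sums on the nonempty
rows: it is onto by `solveHook`, and its kernel is the direction of the face. Truncated subtraction
lets empty rows contribute `0`. -/
theorem dim_teslerFaceIso {a : Fin n → ℕ}
    (S : {S : Fin n → Finset (Fin n) // IsTeslerSupport a S}) :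
    dim (teslerFaceIso a S : Set (Matrix (Fin n) (Fin n) ℝ)) = ∑ r, ((S.1 r).card - 1) := by
  classical
  obtain ⟨S, hS⟩ := S
  let res : (Fin n → ℝ) →ₗ[ℝ] ({r // (S r).Nonempty} → ℝ) := LinearMap.funLeft ℝ ℝ Subtype.val
  let g := res ∘ₗ hookSumₗ ∘ₗ extendPositions S
  have hg : ∀ f r, g f r = hookSum (extendPositions S f) r.1 := fun _ _ => rfl
  have hsurj : Function.Surjective g := by
    intro c
    let c' : Fin n → ℝ := fun r => if h : (S r).Nonempty then c ⟨r, h⟩ else 0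
    refine ⟨fun p => solveHook S c' p.1 p.2, ?_⟩
    have h : extendPositions S (fun p => solveHook S c' p.1 p.2) = solveHook S c' := by
      ext i j
      by_cases hj : j ∈ S i
      · rw [extendPositions_of_mem _ hj]
      · rw [extendPositions_of_notMem _ hj, solveHook_of_notMem _ hj]
    funext r
    rw [hg, h, hookSum_solveHook hS.1 _ r.2]
    simp [c', r.2]
  have hker : (LinearMap.ker g).map (extendPositions S) =
      vectorSpan ℝ (coordFace (Tes a) entry (positions S)) := by
    rw [← coordSupport_solveHook hS,
      (isCoordPolyhedron_Tes a).vectorSpan_coordFace (solveHook_mem_Tes hS),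
      coordSupport_solveHook hS]
    ext M
    simp only [Submodule.mem_map, Submodule.mem_inf, Submodule.mem_iInf, LinearMap.mem_ker]
    constructor
    · rintro ⟨f, hf, rfl⟩
      have hz : ∀ i j, j ∉ S i → extendPositions S f i j = 0 := fun i j h =>
        extendPositions_of_notMem f h
      refine ⟨⟨fun i j hij => hz i j fun h => hij.not_ge (Finset.mem_Ici.1 (hS.1 i h)),
        fun k => ?_⟩, fun p hp => hz p.1 p.2 hp⟩
      by_cases hk : (S k).Nonempty
      · rw [← hg f ⟨k, hk⟩, hf]
        rfl
      · have h := (not_congr (hS.2 k)).1 hk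
        push Not at h
        exact hookSum_eq_zero_of_row_col (fun j => hz k j fun hj => hk ⟨j, hj⟩)
          fun i hi => hz i k (h.2 i hi)
    · rintro ⟨hM, hM'⟩
      have h : extendPositions S (fun p => M p.1 p.2) = M := by
        ext i j
        by_cases hj : j ∈ S i
        · rw [extendPositions_of_mem _ hj]
        · rw [extendPositions_of_notMem _ hj]
          exact (hM' (i, j) hj).symm
      refine ⟨_, funext fun r => ?_, h⟩
      rw [hg, h, hM.2]
      rfl
  have h1 := g.finrank_range_add_finrank_ker
  rw [LinearMap.range_eq_top.2 hsurj, finrank_top, Module.finrank_fintype_fun_eq_card,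
    Module.finrank_fintype_fun_eq_card, Fintype.card_sigma,
    
    (Submodule.equivMapOfInjective _ (extendPositions_injective S) _).finrank_eq, hker] at h1
  change Module.finrank ℝ (vectorSpan ℝ (coordFace (Tes a) entry (positions S))) =
    ∑ r, ((S r).card - 1)
  have h2 : ∑ r, (S r).card = ∑ r, ((S r).card - 1) + Fintype.card {r // (S r).Nonempty} := by
    rw [Fintype.card_subtype, Finset.card_filter, ← Finset.sum_add_distrib]
    refine Finset.sum_congr rfl fun r _ => ?_
    by_cases h : (S r).Nonempty
    · rw [if_pos h, Nat.sub_add_cancel h.card_pos]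
    · simp [Finset.not_nonempty_iff_eq_empty.1 h]
  simp only [Fintype.card_coe] at h1
  omega

end TeslerFaces

/-! ### Patterns as an encoding of supports -/

section Patterns

/-- The combinatorial data of a face of `Δ_1 × ⋯ × Δ_l × P`, with `P` the quotient of
`Δ_m × Δ_{m+1}`: a vertex set for each factor, the one of `Δ_m` being dropped for the faces
that are collapsed. -/
def IsPattern {l m : ℕ}
    (p : ((k : Fin l) → Finset (Fin ((k : ℕ) + 2))) × Finset (Fin (m + 1)) × Finset (Fin (m + 2))) :
    Prop :=
  (∀ k, (p.1 k).Nonempty) ∧ p.2.2.Nonempty ∧ (p.2.1.Nonempty ↔ 1 ∈ p.2.2)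

/-- The poset of patterns, ordered by inclusion of all components. -/
abbrev Pattern (l m : ℕ) : Type :=
  {p : ((k : Fin l) → Finset (Fin ((k : ℕ) + 2))) × Finset (Fin (m + 1)) × Finset (Fin (m + 2)) //
    IsPattern p}

/-- The dimension of the face belonging to a pattern. -/
def patternRank {l m : ℕ}
    (p : ((k : Fin l) → Finset (Fin ((k : ℕ) + 2))) × Finset (Fin (m + 1)) × Finset (Fin (m + 2))) :
    ℕ :=
  ∑ k, ((p.1 k).card - 1) + ((p.2.1.card - 1) + (p.2.2.card - 1))

variable {m : ℕ}

/-- The row of the matrix that corresponds to the factor `Δ_{k+1}`. -/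
def patternRow (k : Fin (m - 1)) : Fin (m + 2) := ⟨m - k, by omega⟩

/-- The columns of the entries on or above the diagonal in the row `patternRow k`. -/
def patternCol (k : Fin (m - 1)) : Fin ((k : ℕ) + 2) ↪ Fin (m + 2) where
  toFun i := ⟨m - k + i, by omega⟩
  inj' i j h := by
    have := congrArg Fin.val h
    dsimp only at this
    omega

theorem patternCol_val (k : Fin (m - 1)) (i : Fin ((k : ℕ) + 2)) :
    (patternCol k i : ℕ) = m - k + i := rfl

theorem patternRow_val (k : Fin (m - 1)) : (patternRow k : ℕ) = m - k := rfl

theorem exists_patternCol_eq {k : Fin (m - 1)} {j : Fin (m + 2)} (h : patternRow k ≤ j) :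
    ∃ i, patternCol k i = j := by
  have h1 : m - k ≤ j := h
  exact ⟨⟨j - (m - k), by omega⟩, Fin.ext (by rw [patternCol_val]; dsimp only; omega)⟩

theorem patternRow_injective : Function.Injective (patternRow : Fin (m - 1) → Fin (m + 2)) := by
  intro k k' h
  have := congrArg Fin.val h
  rw [patternRow_val, patternRow_val] at this
  omega

/-- The rows `patternRow k` are those from `2` to `m`. For `m = 0` the last row is row `1`, so the
final case asks for `1 ≤ m`. -/
theorem row_cases (r : Fin (m + 2)) :
    r = 0 ∨ r = 1 ∨ (∃ k : Fin (m - 1), r = patternRow k) ∨ (1 ≤ m ∧ r = Fin.last (m + 1)) := by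
  rcases Nat.lt_or_ge r 2 with h | h
  · rcases Nat.lt_or_ge r 1 with h' | h'
    · exact Or.inl (Fin.ext (by rw [Fin.val_zero]; omega))
    · exact Or.inr (Or.inl (Fin.ext (by rw [Fin.val_one]; omega)))
  · right; right
    rcases Nat.lt_or_ge r (m + 1) with h' | h'
    · exact Or.inl ⟨⟨m - r, by omega⟩, Fin.ext (by rw [patternRow_val]; dsimp only; omega)⟩
    · exact Or.inr ⟨by omega, Fin.ext (by rw [Fin.val_last]; omega)⟩

/-- The pattern of a family of rows. -/
def rowsPattern (S : Fin (m + 2) → Finset (Fin (m + 2))) :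
    ((k : Fin (m - 1)) → Finset (Fin ((k : ℕ) + 2))) × Finset (Fin (m + 1)) × Finset (Fin (m + 2)) :=
  (fun k => {i | patternCol k i ∈ S (patternRow k)}, Finset.univ.filter fun i => i.succ ∈ S 1, S 0)

/-- The signature conditions, in terms of the entries of `a`. -/
structure IsAdmissible (a : Fin (m + 2) → ℕ) : Prop where
  zero_pos : 0 < a 0
  one_eq : a 1 = 0
  row_pos : ∀ k : Fin (m - 1), 0 < a (patternRow k)

variable {a : Fin (m + 2) → ℕ}

theorem lt_one_iff_eq_zero (i : Fin (m + 2)) : i < 1 ↔ i = 0 := by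
  rw [Fin.lt_def, Fin.ext_iff]
  simp

theorem map_rowsPattern_fst {S : Fin (m + 2) → Finset (Fin (m + 2))}
    (hS : ∀ r, S r ⊆ Finset.Ici r) (k : Fin (m - 1)) :
    ((rowsPattern S).1 k).map (patternCol k) = S (patternRow k) := by
  ext j
  simp only [rowsPattern, Finset.mem_map, Finset.mem_filter, Finset.mem_univ, true_and]
  constructor
  · rintro ⟨i, hi, rfl⟩
    exact hi
  · intro hj
    obtain ⟨i, rfl⟩ := exists_patternCol_eq (Finset.mem_Ici.1 (hS _ hj))
    exact ⟨i, hj, rfl⟩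

theorem map_rowsPattern_snd {S : Fin (m + 2) → Finset (Fin (m + 2))}
    (hS : ∀ r, S r ⊆ Finset.Ici r) :
    (rowsPattern S).2.1.map (Fin.succEmb (m + 1)) = S 1 := by
  ext j
  simp only [rowsPattern, Finset.mem_map, Finset.mem_filter, Finset.mem_univ, true_and]
  constructor
  · rintro ⟨i, hi, rfl⟩
    exact hi
  · intro hj
    have h : j ≠ 0 := by
      rintro rfl
      exact absurd (Finset.mem_Ici.1 (hS _ hj)) (by simp)
    exact ⟨j.pred h, by simpa using hj, by simp⟩

/-- Since `a 1 = 0` and row `0` is the only row above row `1`, row `1` is nonempty iff row `0` uses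
column `1`. -/
theorem isPattern_rowsPattern (ha : IsAdmissible a) {S : Fin (m + 2) → Finset (Fin (m + 2))}
    (hS : IsTeslerSupport a S) : IsPattern (rowsPattern S) := by
  refine ⟨fun k => ?_, (hS.2 0).2 (Or.inl ha.zero_pos), ?_⟩
  · rw [← Finset.map_nonempty (f := patternCol k), map_rowsPattern_fst hS.1]
    exact (hS.2 _).2 (Or.inl (ha.row_pos k))
  · rw [← Finset.map_nonempty (f := Fin.succEmb (m + 1)), map_rowsPattern_snd hS.1, hS.2 1,
      ha.one_eq]
    simp [rowsPattern]

/-- A pattern does not record the last row when `m ≥ 1`. Nothing is lost: that row is empty or its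
diagonal position, and which of the two depends monotonically on the rows above. -/
theorem rowsPattern_le_iff {S T : Fin (m + 2) → Finset (Fin (m + 2))}
    (hS : IsTeslerSupport a S) (hT : IsTeslerSupport a T) :
    rowsPattern S ≤ rowsPattern T ↔ S ≤ T := by
  constructor
  · rintro ⟨h1, h2, h3⟩
    have low : ∀ r, r ≠ Fin.last (m + 1) → S r ⊆ T r := by
      intro r hr
      rcases row_cases r with rfl | rfl | ⟨k, rfl⟩ | ⟨-, h⟩
      · exact h3
      · have := Finset.map_subset_map (f := Fin.succEmb (m + 1)) |>.2 h2
        rwa [map_rowsPattern_snd hS.1, map_rowsPattern_snd hT.1] at this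
      · have := Finset.map_subset_map (f := patternCol k) |>.2 (h1 k)
        rwa [map_rowsPattern_fst hS.1, map_rowsPattern_fst hT.1] at this
      · exact absurd h hr
    intro r
    by_cases hr : r = Fin.last (m + 1)
    · subst hr
      intro j hj
      obtain rfl : j = Fin.last (m + 1) := Fin.last_le_iff.1 (Finset.mem_Ici.1 (hS.1 _ hj))
      obtain ⟨j, hj'⟩ : (T (Fin.last (m + 1))).Nonempty := by
        refine (hT.2 _).2 (((hS.2 _).1 ⟨_, hj⟩).imp_right ?_)
        rintro ⟨i, hi, h⟩
        exact ⟨i, hi, low i hi.ne h⟩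
      rwa [Fin.last_le_iff.1 (Finset.mem_Ici.1 (hT.1 _ hj'))] at hj'
    · exact low r hr
  · intro h
    exact ⟨fun k i hi => by
        simp only [rowsPattern, Finset.mem_filter] at hi ⊢
        exact ⟨hi.1, h _ hi.2⟩, fun i hi => by
        simp only [rowsPattern, Finset.mem_filter] at hi ⊢
        exact ⟨hi.1, h _ hi.2⟩, h 0⟩

theorem exists_rowsPattern_eq (ha : IsAdmissible a)
    {p : ((k : Fin (m - 1)) → Finset (Fin ((k : ℕ) + 2))) × Finset (Fin (m + 1)) ×
      Finset (Fin (m + 2))} (hp : IsPattern p) :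
    ∃ S, IsTeslerSupport a S ∧ rowsPattern S = p := by
  classical
  obtain ⟨f, A, B⟩ := p
  let R : Fin (m + 2) → Finset (Fin (m + 2)) := fun r =>
    {j | (r = 0 ∧ j ∈ B) ∨ (r = 1 ∧ j ∈ A.map (Fin.succEmb (m + 1))) ∨
      ∃ k, r = patternRow k ∧ j ∈ (f k).map (patternCol k)}
  -- `R` places the factors of the pattern in their rows; `S` adds the last row by the support rule.
  -- The guard `1 ≤ m` keeps row `1` from being overwritten when it is the last one.
  let S : Fin (m + 2) → Finset (Fin (m + 2)) := fun r =>
    if 1 ≤ m ∧ r = Fin.last (m + 1) then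
      if 0 < a (Fin.last (m + 1)) ∨ ∃ i < Fin.last (m + 1), Fin.last (m + 1) ∈ R i then
        {Fin.last (m + 1)} else ∅
    else R r
  have h01 : (0 : Fin (m + 2)) ≠ 1 := by simp
  have hrow0 : ∀ k : Fin (m - 1), patternRow k ≠ 0 := fun k h => by
    have := congrArg Fin.val h
    rw [patternRow_val, Fin.val_zero] at this
    omega
  have hrow1 : ∀ k : Fin (m - 1), patternRow k ≠ 1 := fun k h => by
    have := congrArg Fin.val h
    rw [patternRow_val, Fin.val_one] at this
    omega
  have hrowl : ∀ k : Fin (m - 1), patternRow k ≠ Fin.last (m + 1) := fun k h => by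
    have := congrArg Fin.val h
    rw [patternRow_val, Fin.val_last] at this
    omega
  have R0 : R 0 = B := by
    ext j
    simp [R, h01, (hrow0 _).symm]
  have R1 : R 1 = A.map (Fin.succEmb (m + 1)) := by
    ext j
    simp [R, (hrow1 _).symm]
  have Rk : ∀ k, R (patternRow k) = (f k).map (patternCol k) := by
    intro k
    ext j
    simp [R, hrow0, hrow1, patternRow_injective.eq_iff]
  have hlow : ∀ r, ¬(1 ≤ m ∧ r = Fin.last (m + 1)) → S r = R r := fun r h => if_neg h
  have S0 : S 0 = B := by
    rw [hlow, R0]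
    simp
  have S1 : S 1 = A.map (Fin.succEmb (m + 1)) := by
    rw [hlow, R1]
    simp only [Fin.ext_iff, Fin.val_one, Fin.val_last]
    omega
  have Sk : ∀ k, S (patternRow k) = (f k).map (patternCol k) := by
    intro k
    rw [hlow, Rk]
    simp [hrowl]
  refine ⟨S, ⟨fun r => ?_, fun r => ?_⟩, ?_⟩
  · rcases row_cases r with rfl | rfl | ⟨k, rfl⟩ | h
    · intro j _
      simp
    · rw [S1]
      intro j hj
      obtain ⟨i, -, rfl⟩ := Finset.mem_map.1 hj
      simp [Fin.le_def]
    · rw [Sk]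
      intro j hj
      obtain ⟨i, -, rfl⟩ := Finset.mem_map.1 hj
      rw [Finset.mem_Ici, Fin.le_def, patternRow_val, patternCol_val]
      omega
    · simp only [S, if_pos h]
      split_ifs
      · simp [h.2]
      · simp
  · rcases row_cases r with rfl | rfl | ⟨k, rfl⟩ | h
    · rw [S0]
      exact iff_of_true hp.2.1 (Or.inl ha.zero_pos)
    · rw [S1, Finset.map_nonempty, ha.one_eq]
      simp only [lt_one_iff_eq_zero, lt_irrefl, false_or, exists_eq_left, S0]
      exact hp.2.2
    · rw [Sk, Finset.map_nonempty]
      exact iff_of_true (hp.1 k) (Or.inl (ha.row_pos k))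
    · have h1 : S r = if 0 < a (Fin.last (m + 1)) ∨
          ∃ i < Fin.last (m + 1), Fin.last (m + 1) ∈ R i then {Fin.last (m + 1)} else ∅ := if_pos h
      have h2 : ∀ i < r, S i = R i := fun i hi => hlow i fun h' => hi.ne (h'.2.trans h.2.symm)
      have h3 : (∃ i < r, r ∈ S i) ↔ ∃ i < Fin.last (m + 1), Fin.last (m + 1) ∈ R i := by
        rw [← h.2]
        exact exists_congr fun i => and_congr_right fun hi => by rw [h2 i hi]
      rw [h1, h3, h.2]
      split_ifs with hc
      · simpa using hc
      · simpa using hc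
  · refine Prod.ext (funext fun k => ?_) (Prod.ext ?_ S0)
    · ext i
      simp [rowsPattern, Sk]
    · ext i
      simp only [rowsPattern, S1, Finset.mem_filter, Finset.mem_univ, true_and]
      exact Finset.mem_map' (Fin.succEmb (m + 1))

/-- Supports of points of the Tesler polytope and patterns. -/
noncomputable def supportPatternIso (ha : IsAdmissible a) :
    {S : Fin (m + 2) → Finset (Fin (m + 2)) // IsTeslerSupport a S} ≃o Pattern (m - 1) m :=
  RelIso.ofSurjective (OrderEmbedding.ofMapLEIff
    (fun S => ⟨rowsPattern S.1, isPattern_rowsPattern ha S.2⟩)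
    (fun S T => rowsPattern_le_iff S.2 T.2))
    (by
      rintro ⟨p, hp⟩
      obtain ⟨S, hS, h⟩ := exists_rowsPattern_eq ha hp
      exact ⟨⟨S, hS⟩, Subtype.ext h⟩)

theorem patternRank_rowsPattern {S : Fin (m + 2) → Finset (Fin (m + 2))}
    (hS : ∀ r, S r ⊆ Finset.Ici r) :
    patternRank (rowsPattern S) = ∑ r, ((S r).card - 1) := by
  have h1 : ∀ k, ((rowsPattern S).1 k).card = (S (patternRow k)).card := fun k => by
    rw [← map_rowsPattern_fst hS, Finset.card_map]
  have h2 : (rowsPattern S).2.1.card = (S 1).card := by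
    rw [← map_rowsPattern_snd hS, Finset.card_map]
  have hlast : (S (Fin.last (m + 1))).card - 1 = 0 := by
    have : (S (Fin.last (m + 1))).card ≤ 1 :=
      Finset.card_le_one.2 fun i hi j hj =>
        (Fin.last_le_iff.1 (Finset.mem_Ici.1 (hS _ hi))).trans
          (Fin.last_le_iff.1 (Finset.mem_Ici.1 (hS _ hj))).symm
    omega
  simp only [patternRank, h1, h2]
  change _ + (_ + ((S 0).card - 1)) = _
  rw [Fin.sum_univ_succ, Fin.sum_univ_succ]
  -- The factors are listed from row `m` down to row `2`, hence the reversal; the last row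
  -- contributes `0`.
  have key : ∑ k, ((S (patternRow k)).card - 1) =
      ∑ i : Fin m, ((S i.succ.succ).card - 1) := by
    rcases m with _ | l
    · rfl
    · rw [Fin.sum_univ_castSucc, ← Equiv.sum_comp (Fin.revPerm (n := l))]
      have h3 : (Fin.last l).succ.succ = Fin.last (l + 1 + 1) := rfl
      rw [h3, hlast, add_zero]
      refine Finset.sum_congr rfl fun k _ => ?_
      have h4 : patternRow (m := l + 1) k =
          (Fin.revPerm (n := l) k).castSucc.succ.succ :=
        Fin.ext (by
          rw [patternRow_val]
          have := k.2
          simp only [Fin.revPerm_apply, Fin.val_rev, Fin.val_succ, Fin.val_castSucc]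
          omega)
      rw [h4]
  rw [key]
  simp only [Fin.succ_zero_eq_one]
  omega

end Patterns

/-! ### Faces of the product of simplices with `P` -/

section ProductFaces

/-- The face of the standard simplex with vertex set `S`. -/
def simplexFace {d : ℕ} (S : Finset (Fin d)) : Set (Fin d → ℝ) :=
  {x | x ∈ stdSimplex ℝ (Fin d) ∧ ∀ i ∉ S, x i = 0}

/-- The barycenter; its full support lets inclusions of faces be read off from a single point. -/
theorem exists_mem_simplexFace {d : ℕ} {S : Finset (Fin d)} (hS : S.Nonempty) :
    ∃ x ∈ simplexFace S, ∀ i ∈ S, x i ≠ 0 := by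
  have h0 : (S.card : ℝ) ≠ 0 := by exact_mod_cast hS.card_pos.ne'
  refine ⟨fun i => if i ∈ S then (S.card : ℝ)⁻¹ else 0, ⟨⟨fun i => ?_, ?_⟩, fun i hi => if_neg hi⟩,
    fun i hi => ?_⟩
  · dsimp only
    split_ifs <;> positivity
  · simp [h0]
  · simp [hi, h0]

theorem simplexFace_nonempty {d : ℕ} {S : Finset (Fin d)} (hS : S.Nonempty) :
    (simplexFace S).Nonempty :=
  let ⟨x, hx, _⟩ := exists_mem_simplexFace hS
  ⟨x, hx⟩

theorem simplexFace_mono {d : ℕ} {S T : Finset (Fin d)} (h : S ⊆ T) :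
    simplexFace S ⊆ simplexFace T := fun _ hx => ⟨hx.1, fun i hi => hx.2 i fun hS => hi (h hS)⟩

theorem subset_of_mem_simplexFace {d : ℕ} {S T : Finset (Fin d)} {x : Fin d → ℝ}
    (hx : x ∈ simplexFace T) (h : ∀ i ∈ S, x i ≠ 0) : S ⊆ T := fun i hi =>
  by_contra fun hT => h i hi (hx.2 i hT)

theorem simplexFace_subset_iff {d : ℕ} {S T : Finset (Fin d)} (hS : S.Nonempty) :
    simplexFace S ⊆ simplexFace T ↔ S ⊆ T := by
  refine ⟨fun h => ?_, simplexFace_mono⟩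
  obtain ⟨x, hx, hxS⟩ := exists_mem_simplexFace hS
  exact subset_of_mem_simplexFace (h hx) hxS

theorem exists_ne_zero_of_mem_stdSimplex {d : ℕ} {x : Fin d → ℝ}
    (hx : x ∈ stdSimplex ℝ (Fin d)) : (Finset.univ.filter fun i => x i ≠ 0).Nonempty := by
  by_contra h
  rw [Finset.not_nonempty_iff_eq_empty, Finset.filter_eq_empty_iff] at h
  have := hx.2
  rw [Finset.sum_eq_zero fun i hi => not_not.1 (h hi)] at this
  exact zero_ne_one this

theorem sub_mem_of_mem_stdSimplex {d : ℕ} {x y : Fin d → ℝ} (hx : x ∈ stdSimplex ℝ (Fin d))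
    (hy : y ∈ stdSimplex ℝ (Fin d)) : ∑ i, (y - x) i = 0 := by
  simp only [Pi.sub_apply, Finset.sum_sub_distrib, hx.2, hy.2, sub_self]

theorem add_mem_stdSimplex {d : ℕ} {x v : Fin d → ℝ} (hx : x ∈ stdSimplex ℝ (Fin d))
    (hv : ∑ i, v i = 0) (h : ∀ i, 0 ≤ (x + v) i) : x + v ∈ stdSimplex ℝ (Fin d) :=
  ⟨h, by simp only [Pi.add_apply, Finset.sum_add_distrib, hx.2, hv, add_zero]⟩

variable {l m : ℕ}

/-- The coordinates on the space containing the product of simplices. -/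
noncomputable def simplexCoord (p : Σ k : Fin l, Fin ((k : ℕ) + 2)) :
    ((k : Fin l) → Fin ((k : ℕ) + 2) → ℝ) →L[ℝ] ℝ :=
  (ContinuousLinearMap.proj (R := ℝ) (φ := fun _ : Fin ((p.1 : ℕ) + 2) => ℝ) p.2).comp
    (ContinuousLinearMap.proj (R := ℝ) (φ := fun k : Fin l => Fin ((k : ℕ) + 2) → ℝ) p.1)

theorem simplexCoord_apply (p : Σ k : Fin l, Fin ((k : ℕ) + 2))
    (x : (k : Fin l) → Fin ((k : ℕ) + 2) → ℝ) : simplexCoord p x = x p.1 p.2 := rfl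

theorem isCoordPolyhedron_simplexProduct :
    IsCoordPolyhedron (simplexProduct l)
      simplexCoord
      { carrier := {v | ∀ k, ∑ i, v k i = 0}
        add_mem' := fun hv hw k => by
          simp only [Pi.add_apply, Finset.sum_add_distrib, hv k, hw k, add_zero]
        zero_mem' := fun k => by simp
        smul_mem' := fun c v hv k => by
          simp only [Pi.smul_apply, ← Finset.smul_sum, hv k, smul_zero] } where
  nonneg _ hx p := (hx p.1 trivial).1 p.2
  sub_mem _ hx _ hy k := sub_mem_of_mem_stdSimplex (hx k trivial) (hy k trivial)
  add_mem _ hx _ hv h k _ := add_mem_stdSimplex (hx k trivial) (hv k) fun i => h ⟨k, i⟩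

theorem isFace_simplexProduct_iff {F : Set ((k : Fin l) → Fin ((k : ℕ) + 2) → ℝ)} :
    IsFace (simplexProduct l) F ↔
      ∃ f : (k : Fin l) → Finset (Fin ((k : ℕ) + 2)),
        (∀ k, (f k).Nonempty) ∧ F = Set.univ.pi fun k => simplexFace (f k) := by
  have hP := isCoordPolyhedron_simplexProduct (l := l)
  have key : ∀ f : (k : Fin l) → Finset (Fin ((k : ℕ) + 2)),
      coordFace (simplexProduct l) simplexCoord
        {p | p.2 ∈ f p.1} = Set.univ.pi fun k => simplexFace (f k) := by
    intro f
    ext x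
    exact ⟨fun h k _ => ⟨h.1 k trivial, fun i hi => h.2 ⟨k, i⟩ hi⟩,
      fun h => ⟨fun k _ => (h k trivial).1, fun p hp => (h p.1 trivial).2 p.2 hp⟩⟩
  constructor
  · intro hF
    obtain ⟨x, hx, rfl⟩ := hP.isFace_iff.1 hF
    refine ⟨fun k => Finset.univ.filter fun i => x k i ≠ 0,
      fun k => exists_ne_zero_of_mem_stdSimplex (hx k trivial), ?_⟩
    rw [← key]
    congr 1
    ext p
    simp [coordSupport, simplexCoord_apply]
  · rintro ⟨f, hf, rfl⟩
    rw [← key]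
    refine hP.isFace_coordFace ?_
    rw [key]
    exact Set.univ_pi_nonempty_iff.2 fun k => simplexFace_nonempty (hf k)

theorem isCoordPolyhedron_twoSimplices :
    IsCoordPolyhedron (twoSimplices m)
      (Sum.elim (fun i => (ContinuousLinearMap.proj i).comp (ContinuousLinearMap.fst ℝ _ _))
        (fun i => (ContinuousLinearMap.proj i).comp (ContinuousLinearMap.snd ℝ _ _)))
      { carrier := {v | ∑ i, v.1 i = 0 ∧ ∑ i, v.2 i = 0}
        add_mem' := fun hv hw => by
          constructor <;>
          simp only [Prod.fst_add, Prod.snd_add, Pi.add_apply, Finset.sum_add_distrib, hv.1, hw.1,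
            hv.2, hw.2, add_zero]
        zero_mem' := by simp
        smul_mem' := fun c v hv => by
          constructor <;>
          simp only [Prod.smul_fst, Prod.smul_snd, Pi.smul_apply, ← Finset.smul_sum, hv.1, hv.2,
            smul_zero] } where
  nonneg x hx p := by
    rcases p with i | i
    · exact hx.1.1 i
    · exact hx.2.1 i
  sub_mem x hx y hy :=
    ⟨sub_mem_of_mem_stdSimplex hx.1 hy.1, sub_mem_of_mem_stdSimplex hx.2 hy.2⟩
  add_mem x hx v hv h :=
    ⟨add_mem_stdSimplex hx.1 hv.1 fun i => h (Sum.inl i),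
      add_mem_stdSimplex hx.2 hv.2 fun i => h (Sum.inr i)⟩

theorem isFace_twoSimplices_iff {F : Set ((Fin (m + 1) → ℝ) × (Fin (m + 2) → ℝ))} :
    IsFace (twoSimplices m) F ↔
      ∃ A B, A.Nonempty ∧ B.Nonempty ∧ F = simplexFace A ×ˢ simplexFace B := by
  have hP := isCoordPolyhedron_twoSimplices (m := m)
  have key : ∀ (A : Finset (Fin (m + 1))) (B : Finset (Fin (m + 2))),
      coordFace (twoSimplices m)
        (Sum.elim (fun i => (ContinuousLinearMap.proj i).comp (ContinuousLinearMap.fst ℝ _ _))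
          (fun i => (ContinuousLinearMap.proj i).comp (ContinuousLinearMap.snd ℝ _ _)))
        {p | Sum.elim (· ∈ A) (· ∈ B) p} = simplexFace A ×ˢ simplexFace B := by
    intro A B
    ext x
    refine ⟨fun h => ⟨⟨h.1.1, fun i hi => h.2 (Sum.inl i) hi⟩,
      ⟨h.1.2, fun i hi => h.2 (Sum.inr i) hi⟩⟩, fun h => ⟨⟨h.1.1, h.2.1⟩, fun p hp => ?_⟩⟩
    rcases p with i | i
    · exact h.1.2 i hp
    · exact h.2.2 i hp
  constructor
  · intro hF
    obtain ⟨x, hx, rfl⟩ := hP.isFace_iff.1 hF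
    refine ⟨Finset.univ.filter fun i => x.1 i ≠ 0, Finset.univ.filter fun i => x.2 i ≠ 0,
      exists_ne_zero_of_mem_stdSimplex hx.1, exists_ne_zero_of_mem_stdSimplex hx.2, ?_⟩
    rw [← key]
    congr 1
    ext (i | i) <;> simp [coordSupport]
  · rintro ⟨A, B, hA, hB, rfl⟩
    rw [← key]
    refine hP.isFace_coordFace ?_
    rw [key]
    exact (simplexFace_nonempty hA).prod (simplexFace_nonempty hB)

theorem quotientMap_eq_iff {x y : twoSimplices m} :
    quotientMap m x = quotientMap m y ↔ x = y ∨ (x.1.2 = y.1.2 ∧ x.1.2 1 = 0) :=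
  Quotient.eq (r := collapse m)

/-- The face of `P` that belongs to a pair of vertex sets. -/
def quotientFace (A : Finset (Fin (m + 1))) (B : Finset (Fin (m + 2))) :
    Set (QuotientPolytope m) :=
  quotientMap m '' {x | x.1.2 ∈ simplexFace B ∧ (x.1.2 1 = 0 ∨ x.1.1 ∈ simplexFace A)}

/-- The set whose image defines `quotientFace` is saturated for `collapse`, so any representative
decides membership. -/
theorem quotientMap_mem_quotientFace_iff {A : Finset (Fin (m + 1))} {B : Finset (Fin (m + 2))}
    {x : twoSimplices m} :
    quotientMap m x ∈ quotientFace A B ↔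
      x.1.2 ∈ simplexFace B ∧ (x.1.2 1 = 0 ∨ x.1.1 ∈ simplexFace A) := by
  constructor
  · rintro ⟨y, hy, hyx⟩
    rcases quotientMap_eq_iff.1 hyx with rfl | ⟨h1, h2⟩
    · exact hy
    · exact ⟨h1 ▸ hy.1, Or.inl (h1 ▸ h2)⟩
  · exact fun h => ⟨x, h, rfl⟩

theorem image_quotientMap_prod {A : Finset (Fin (m + 1))} {B : Finset (Fin (m + 2))}
    (hA : A.Nonempty) :
    quotientMap m '' (Subtype.val ⁻¹' (simplexFace A ×ˢ simplexFace B)) = quotientFace A B := by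
  apply Set.Subset.antisymm
  · rintro _ ⟨x, hx, rfl⟩
    exact ⟨x, ⟨hx.2, Or.inr hx.1⟩, rfl⟩
  · rintro _ ⟨x, ⟨hx, h | h⟩, rfl⟩
    · obtain ⟨p, hp⟩ := simplexFace_nonempty hA
      exact ⟨⟨(p, x.1.2), hp.1, hx.1⟩, ⟨hp, hx⟩, quotientMap_eq_iff.2 (Or.inr ⟨rfl, h⟩)⟩
    · exact ⟨x, ⟨h, hx⟩, rfl⟩

theorem quotientFace_eq_of_notMem {A A' : Finset (Fin (m + 1))} {B : Finset (Fin (m + 2))}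
    (h : 1 ∉ B) : quotientFace A B = quotientFace A' B := by
  rw [quotientFace, quotientFace]
  congr 1
  ext x
  exact and_congr_right fun hx => iff_of_true (Or.inl (hx.2 1 h)) (Or.inl (hx.2 1 h))

/-- If `1 ∉ B`, every fibre over the face is collapsed and `A` is irrelevant; choosing `A = ∅` makes
the label unique. -/
theorem isQuotientFace_iff {G : Set (QuotientPolytope m)} :
    IsQuotientFace m G ↔
      ∃ A B, B.Nonempty ∧ (A.Nonempty ↔ 1 ∈ B) ∧ G = quotientFace A B := by
  constructor
  · rintro ⟨F, hF, rfl⟩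
    obtain ⟨A, B, hA, hB, rfl⟩ := isFace_twoSimplices_iff.1 hF
    rw [image_quotientMap_prod hA]
    by_cases h : 1 ∈ B
    · exact ⟨A, B, hB, iff_of_true hA h, rfl⟩
    · exact ⟨∅, B, hB, iff_of_false (by simp) h, quotientFace_eq_of_notMem h⟩
  · rintro ⟨A, B, hB, hAB, rfl⟩
    by_cases h : 1 ∈ B
    · exact ⟨_, isFace_twoSimplices_iff.2 ⟨A, B, hAB.2 h, hB, rfl⟩,
        (image_quotientMap_prod (hAB.2 h)).symm⟩
    · refine ⟨_, isFace_twoSimplices_iff.2 ⟨Finset.univ, B, Finset.univ_nonempty, hB, rfl⟩, ?_⟩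
      rw [image_quotientMap_prod Finset.univ_nonempty]
      exact quotientFace_eq_of_notMem h

theorem exists_mem_quotientFace {A : Finset (Fin (m + 1))} {B : Finset (Fin (m + 2))}
    (hB : B.Nonempty) (hAB : A.Nonempty ↔ 1 ∈ B) :
    ∃ x : twoSimplices m, quotientMap m x ∈ quotientFace A B ∧ (∀ i ∈ A, x.1.1 i ≠ 0) ∧
      ∀ i ∈ B, x.1.2 i ≠ 0 := by
  obtain ⟨q, hq, hqB⟩ := exists_mem_simplexFace hB
  by_cases h : A.Nonempty
  · obtain ⟨p, hp, hpA⟩ := exists_mem_simplexFace h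
    exact ⟨⟨(p, q), hp.1, hq.1⟩, quotientMap_mem_quotientFace_iff.2 ⟨hq, Or.inr hp⟩, hpA, hqB⟩
  · obtain ⟨p, hp⟩ := simplexFace_nonempty (Finset.univ_nonempty (α := Fin (m + 1)))
    refine ⟨⟨(p, q), hp.1, hq.1⟩,
      quotientMap_mem_quotientFace_iff.2 ⟨hq, Or.inl (hq.2 1 fun h1 => h (hAB.2 h1))⟩, ?_, hqB⟩
    rw [Finset.not_nonempty_iff_eq_empty.1 h]
    simp

theorem quotientFace_subset_iff {A A' : Finset (Fin (m + 1))} {B B' : Finset (Fin (m + 2))}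
    (hB : B.Nonempty) (hAB : A.Nonempty ↔ 1 ∈ B) :
    quotientFace A B ⊆ quotientFace A' B' ↔ A ⊆ A' ∧ B ⊆ B' := by
  constructor
  · intro h
    obtain ⟨x, hx, hxA, hxB⟩ := exists_mem_quotientFace hB hAB
    have hx' := quotientMap_mem_quotientFace_iff.1 (h hx)
    refine ⟨fun i hi => ?_, subset_of_mem_simplexFace hx'.1 hxB⟩
    exact subset_of_mem_simplexFace (hx'.2.resolve_left (hxB 1 (hAB.1 ⟨i, hi⟩))) hxA hi
  · rintro ⟨hA, hB'⟩
    exact Set.image_mono fun x hx =>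
      ⟨simplexFace_mono hB' hx.1, hx.2.imp_right fun h => simplexFace_mono hA h⟩

theorem pi_simplexFace_subset_iff {f g : (k : Fin l) → Finset (Fin ((k : ℕ) + 2))}
    (hf : ∀ k, (f k).Nonempty) :
    ((Set.univ.pi fun k => simplexFace (f k)) ⊆ Set.univ.pi fun k => simplexFace (g k)) ↔
      f ≤ g := by
  rw [Set.univ_pi_subset_univ_pi_iff]
  constructor
  · rintro (h | ⟨k, hk⟩)
    · exact fun k => (simplexFace_subset_iff (hf k)).1 (h k)
    · exact absurd hk (simplexFace_nonempty (hf k)).ne_empty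
  · exact fun h => Or.inl fun k => simplexFace_mono (h k)

/-- Patterns and faces of the product polytope. -/
noncomputable def patternFaceIso (l m : ℕ) :
    Pattern l m ≃o ProductFacePoset (simplexProduct l) m :=
  RelIso.ofSurjective (OrderEmbedding.ofMapLEIff
    (fun p => ⟨(Set.univ.pi fun k => simplexFace (p.1.1 k)) ×ˢ quotientFace p.1.2.1 p.1.2.2,
      _, _, isFace_simplexProduct_iff.2 ⟨p.1.1, p.2.1, rfl⟩,
      isQuotientFace_iff.2 ⟨p.1.2.1, p.1.2.2, p.2.2.1, p.2.2.2, rfl⟩, rfl⟩)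
    (fun p q => by
      have h1 : (Set.univ.pi fun k => simplexFace (p.1.1 k)).Nonempty :=
        Set.univ_pi_nonempty_iff.2 fun k => simplexFace_nonempty (p.2.1 k)
      have h2 : (quotientFace p.1.2.1 p.1.2.2).Nonempty :=
        let ⟨x, hx, _⟩ := exists_mem_quotientFace p.2.2.1 p.2.2.2
        ⟨_, hx⟩
      rw [Subtype.mk_le_mk, Set.prod_subset_prod_iff,
        pi_simplexFace_subset_iff p.2.1, quotientFace_subset_iff p.2.2.1 p.2.2.2,
        or_iff_left (by simp [h1.ne_empty, h2.ne_empty])]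
      rfl))
    (by
      rintro ⟨H, X, Y, hX, hY, rfl⟩
      obtain ⟨f, hf, rfl⟩ := isFace_simplexProduct_iff.1 hX
      obtain ⟨A, B, hB, hAB, rfl⟩ := isQuotientFace_iff.1 hY
      exact ⟨⟨(f, A, B), hf, hB, hAB⟩, rfl⟩)

end ProductFaces

/-! ### Generating functions of patterns by rank -/

section Counting

open Finset Polynomial

variable {R : Type*} [CommRing R] {α : Type*}

theorem sum_powerset_pow_card (y : R) (s : Finset α) :
    ∑ S ∈ s.powerset, y ^ S.card = (y + 1) ^ s.card := by
  have := Finset.sum_pow_mul_eq_add_pow y 1 s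
  simpa using this

theorem mul_sum_powerset_nonempty (y : R) (s : Finset α) :
    y * (∑ S ∈ s.powerset with S.Nonempty, y ^ (S.card - 1)) + 1 = (y + 1) ^ s.card := by
  rw [← sum_powerset_pow_card, Finset.mul_sum,
    ← Finset.sum_filter_add_sum_filter_not s.powerset Finset.Nonempty]
  congr 1
  · refine Finset.sum_congr rfl fun S hS => ?_
    rw [← pow_succ', Nat.sub_add_cancel (Finset.mem_filter.1 hS).2.card_pos]
  · have : s.powerset.filter (fun S => ¬ S.Nonempty) = {∅} := by
      ext S
      simp only [Finset.mem_filter, Finset.mem_powerset, Finset.not_nonempty_iff_eq_empty,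
        Finset.mem_singleton, and_iff_right_iff_imp]
      rintro rfl
      simp
    rw [this]
    simp

/-- The `h`-polynomial of a simplex: both sides times `X - 1` equal `X ^ s.card - 1`. -/
theorem sum_powerset_nonempty_X_sub_one (s : Finset α) :
    ∑ S ∈ s.powerset with S.Nonempty, (X - 1 : ℤ[X]) ^ (S.card - 1) =
      ∑ j ∈ range s.card, X ^ j := by
  have h := mul_sum_powerset_nonempty (X - 1 : ℤ[X]) s
  have h1 : (X - 1 : ℤ[X]) ≠ 0 := X_sub_C_ne_zero (1 : ℤ)
  apply mul_left_cancel₀ h1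
  rw [mul_geom_sum, eq_sub_iff_add_eq, h, sub_add_cancel]

theorem sum_powerset_mem_pow_card [DecidableEq α] (y : R) {s : Finset α} {b : α} (hb : b ∈ s) :
    ∑ S ∈ s.powerset with b ∈ S, y ^ (S.card - 1) = (y + 1) ^ (s.card - 1) := by
  have h : b ∉ s.erase b := Finset.notMem_erase b s
  conv_lhs => rw [← Finset.insert_erase hb]
  rw [Finset.sum_filter, Finset.sum_powerset_insert h, ← Finset.card_erase_of_mem hb,
    ← sum_powerset_pow_card, Finset.sum_eq_zero, zero_add]
  · refine Finset.sum_congr rfl fun S hS => ?_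
    rw [if_pos (Finset.mem_insert_self _ _),
      Finset.card_insert_of_notMem fun hS' => h (Finset.mem_powerset.1 hS hS'),
      Nat.add_sub_cancel]
  · intro S hS
    exact if_neg fun hS' => h (Finset.mem_powerset.1 hS hS')

theorem sum_powerset_mem_pow_card' [DecidableEq α] (y : R) {s : Finset α} {b : α} (hb : b ∈ s) :
    ∑ S ∈ s.powerset with b ∈ S, y ^ S.card = y * (y + 1) ^ (s.card - 1) := by
  rw [← sum_powerset_mem_pow_card y hb, Finset.mul_sum]
  refine Finset.sum_congr rfl fun S hS => ?_
  rw [← pow_succ', Nat.sub_add_cancel (Finset.card_pos.2 ⟨b, (Finset.mem_filter.1 hS).2⟩)]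

variable {l m : ℕ}

theorem sum_patternRank_eq (y : R) (Q : (k : Fin l) → Finset (Fin ((k : ℕ) + 2)) → Prop)
    (T : Finset (Fin (m + 1)) × Finset (Fin (m + 2)) → Prop)
    [∀ k, DecidablePred (Q k)] [DecidablePred T] :
    ∑ p with (∀ k, Q k (p.1 k)) ∧ T p.2, y ^ patternRank p =
      (∏ k, ∑ S with Q k S, y ^ (S.card - 1)) *
        ∑ q with T q, y ^ (q.1.card - 1) * y ^ (q.2.card - 1) := by
  have : (univ.filter fun p : ((k : Fin l) → Finset (Fin ((k : ℕ) + 2))) × Finset (Fin (m + 1)) ×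
      Finset (Fin (m + 2)) => (∀ k, Q k (p.1 k)) ∧ T p.2) =
      (Fintype.piFinset fun k => univ.filter (Q k)) ×ˢ univ.filter T := by
    ext p
    simp
  rw [this, Finset.sum_product, Finset.prod_univ_sum, Finset.sum_mul_sum]
  refine Finset.sum_congr rfl fun f _ => Finset.sum_congr rfl fun q _ => ?_
  rw [patternRank, pow_add, pow_add, Finset.prod_pow_eq_pow_sum]

/-- The factor `w(B) ∑_A w(A)` is computed by splitting according to whether `1 ∈ B`. -/
theorem sum_pair_eq (y : R) (A₀ : Finset (Fin (m + 1))) (B₀ : Finset (Fin (m + 2))) :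
    ∑ q : Finset (Fin (m + 1)) × Finset (Fin (m + 2))
        with (q.2.Nonempty ∧ (q.1.Nonempty ↔ 1 ∈ q.2)) ∧ A₀ ⊆ q.1 ∧ B₀ ⊆ q.2,
        y ^ (q.1.card - 1) * y ^ (q.2.card - 1) =
      (if A₀ = ∅ then ∑ B ∈ (univ.erase (1 : Fin (m + 2))).powerset with B.Nonempty ∧ B₀ ⊆ B,
        y ^ (B.card - 1) else 0) +
      (∑ B ∈ (univ.erase (1 : Fin (m + 2))).powerset with B₀ ⊆ insert 1 B, y ^ B.card) *
        ∑ A with A.Nonempty ∧ A₀ ⊆ A, y ^ (A.card - 1) := by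
  obtain ⟨s, hs⟩ : ∃ s, s = univ.erase (1 : Fin (m + 2)) := ⟨_, rfl⟩
  have h1 : 1 ∉ s := hs ▸ Finset.notMem_erase _ _
  have hu : (univ : Finset (Finset (Fin (m + 2)))) = (insert 1 s).powerset := by
    rw [hs, Finset.insert_erase (Finset.mem_univ _), Finset.powerset_univ]
  rw [← hs, Finset.sum_filter, Fintype.sum_prod_type_right, hu, Finset.sum_powerset_insert h1]
  congr 1
  · have key : ∀ B ∈ s.powerset,
        (∑ A : Finset (Fin (m + 1)), if (B.Nonempty ∧ (A.Nonempty ↔ 1 ∈ B)) ∧ A₀ ⊆ A ∧ B₀ ⊆ B then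
          y ^ (A.card - 1) * y ^ (B.card - 1) else 0) =
        if A₀ = ∅ then if B.Nonempty ∧ B₀ ⊆ B then y ^ (B.card - 1) else 0 else 0 := by
      intro B hB
      have hB1 : 1 ∉ B := fun h => h1 (Finset.mem_powerset.1 hB h)
      -- For `1 ∉ B` only `A = ∅` is allowed, and its weight is `y ^ (0 - 1) = 1` by truncated
      -- subtraction.
      rw [Finset.sum_eq_single ∅]
      · simp only [hB1, Finset.not_nonempty_empty, iff_self, and_true, Finset.subset_empty,
          Finset.card_empty, Nat.zero_sub, pow_zero, one_mul]
        split_ifs <;> first | rfl | tauto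
      · intro A _ hA
        refine if_neg fun h => hB1 (h.1.2.1 (Finset.nonempty_iff_ne_empty.2 hA))
      · simp
    rw [Finset.sum_congr rfl key]
    split_ifs
    · rw [Finset.sum_filter]
    · simp
  · rw [Finset.sum_filter, Finset.sum_filter, Finset.sum_mul_sum]
    refine Finset.sum_congr rfl fun B hB => Finset.sum_congr (by simp) fun A _ => ?_
    have hB1 : 1 ∉ B := fun h => h1 (Finset.mem_powerset.1 hB h)
    rw [Finset.card_insert_of_notMem hB1, Nat.add_sub_cancel]
    simp only [Finset.mem_insert_self, Finset.insert_nonempty, true_and, iff_true]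
    split_ifs <;> first | ring1 | (exfalso; tauto)

/-- In the factor of `P`, the sets `B` without `1` give a geometric sum of length `m + 1`. Those
with `1` give `X ^ (m + 1)` times the same sum, which now comes from `A`. -/
theorem sum_pattern_X_sub_one [Fintype (Pattern l m)] :
    ∑ p : Pattern l m, (X - 1 : ℤ[X]) ^ patternRank p.1 =
      (∏ k : Fin l, ∑ j ∈ range ((k : ℕ) + 2), X ^ j) *
        ((1 + X ^ (m + 1)) * ∑ j ∈ range (m + 1), X ^ j) := by
  have h1 := sum_patternRank_eq (X - 1 : ℤ[X]) (fun (k : Fin l) S => S.Nonempty)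
    (fun q : Finset (Fin (m + 1)) × Finset (Fin (m + 2)) =>
      (q.2.Nonempty ∧ (q.1.Nonempty ↔ 1 ∈ q.2)) ∧ ∅ ⊆ q.1 ∧ ∅ ⊆ q.2)
  have hs : ∀ d, ∑ S : Finset (Fin d) with S.Nonempty, (X - 1 : ℤ[X]) ^ (S.card - 1) =
      ∑ j ∈ range d, X ^ j := fun d => by
    simpa using sum_powerset_nonempty_X_sub_one (univ : Finset (Fin d))
  have h2 := sum_pair_eq (X - 1 : ℤ[X]) (∅ : Finset (Fin (m + 1))) (∅ : Finset (Fin (m + 2)))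
  simp only [Finset.empty_subset, and_true, if_true, Finset.filter_true, hs,
    sum_powerset_nonempty_X_sub_one, sum_powerset_pow_card, Finset.card_erase_of_mem
    (Finset.mem_univ _), Finset.card_univ, Fintype.card_fin, sub_add_cancel] at h1 h2
  rw [show m + 2 - 1 = m + 1 from rfl] at h2
  rw [add_mul, one_mul, ← h2, ← h1]
  refine (Finset.sum_subtype _ (fun p => ?_) fun p => (X - 1 : ℤ[X]) ^ patternRank p).symm
  simp [IsPattern]

/-- The largest pattern. -/
def topPattern (l m : ℕ) : Pattern l m :=
  ⟨(fun _ => univ, univ, univ), fun _ => univ_nonempty, univ_nonempty, by simp⟩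

theorem le_topPattern (t : Pattern l m) : t ≤ topPattern l m :=
  ⟨fun _ => subset_univ _, subset_univ _, subset_univ _⟩

/-- A pattern of rank `0` has singleton components, except that `A` is empty when `B ≠ {1}`. Each
simplex factor contributes a power of `y + 1`; for `P` the two kinds of vertices are treated
separately. -/
theorem sum_pattern_ge [Fintype (Pattern l m)] (y : R) (t₀ : Pattern l m)
    [DecidablePred (t₀ ≤ ·)] (h₀ : patternRank t₀.1 = 0) :
    ∑ t : Pattern l m with t₀ ≤ t, y ^ patternRank t.1 =
      (y + 1) ^ patternRank (topPattern l m).1 := by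
  have hlhs : ∑ t : Pattern l m with t₀ ≤ t, y ^ patternRank t.1 =
      ∑ p with (∀ k, (p.1 k).Nonempty ∧ t₀.1.1 k ⊆ p.1 k) ∧
        ((p.2.2.Nonempty ∧ (p.2.1.Nonempty ↔ (1 : Fin (m + 2)) ∈ p.2.2)) ∧
          t₀.1.2.1 ⊆ p.2.1 ∧ t₀.1.2.2 ⊆ p.2.2),
        y ^ patternRank p := by
    classical
    have h := Finset.sum_subtype (univ.filter (IsPattern (l := l) (m := m)))
      (p := IsPattern) (F := ‹Fintype (Pattern l m)›) (by simp) fun p => if t₀.1 ≤ p then y ^ patternRank p else 0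
    rw [← Finset.sum_filter, Finset.filter_filter] at h
    rw [Finset.sum_filter]
    refine (Eq.trans ?_ h.symm).trans
      (Finset.sum_congr (Finset.filter_congr fun p _ => ?_) fun _ _ => rfl)
    · refine Finset.sum_congr rfl fun t _ => ?_
      by_cases ht : t₀ ≤ t
      · exact (if_pos ht).trans (if_pos (show t₀.1 ≤ t.1 from ht)).symm
      · exact (if_neg ht).trans (if_neg (show ¬ t₀.1 ≤ t.1 from ht)).symm
    simp only [IsPattern, forall_and, Prod.le_def, Pi.le_def]
    tauto
  obtain ⟨⟨f, A, B⟩, hf, hB, hAB⟩ := t₀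
  simp only [patternRank, Nat.add_eq_zero_iff, Finset.sum_eq_zero_iff, Finset.mem_univ,
    true_imp_iff] at h₀ hf hB hAB
  obtain ⟨hf0, hA0, hB0⟩ := h₀
  have hfk : ∀ k, ∑ S with S.Nonempty ∧ f k ⊆ S, y ^ (S.card - 1) = (y + 1) ^ ((k : ℕ) + 1) := by
    intro k
    obtain ⟨x, hx⟩ := Finset.card_eq_one.1
      (le_antisymm (Nat.sub_eq_zero_iff_le.1 (hf0 k)) (hf k).card_pos)
    have h := sum_powerset_mem_pow_card y (Finset.mem_univ x)
    rw [Finset.card_univ, Fintype.card_fin] at h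
    rw [hx, ← show (k : ℕ) + 2 - 1 = k + 1 from rfl, ← h]
    refine Finset.sum_congr ?_ fun _ _ => rfl
    ext S
    simp only [Finset.mem_filter, Finset.mem_univ, Finset.singleton_subset_iff,
      Finset.powerset_univ, true_and, and_iff_right_iff_imp]
    exact fun h => ⟨x, h⟩
  have hcard : (univ.erase (1 : Fin (m + 2))).card = m + 1 := by
    rw [Finset.card_erase_of_mem (Finset.mem_univ _), Finset.card_univ, Fintype.card_fin]
    rfl
  have hpair : ∑ q : Finset (Fin (m + 1)) × Finset (Fin (m + 2))
      with (q.2.Nonempty ∧ (q.1.Nonempty ↔ 1 ∈ q.2)) ∧ A ⊆ q.1 ∧ B ⊆ q.2,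
      y ^ (q.1.card - 1) * y ^ (q.2.card - 1) = (y + 1) ^ (m + (m + 1)) := by
    rw [sum_pair_eq]
    obtain ⟨b, rfl⟩ := Finset.card_eq_one.1
      (le_antisymm (Nat.sub_eq_zero_iff_le.1 hB0) hB.card_pos)
    by_cases hb : b = 1
    · subst hb
      have hA := hAB.2 (Finset.mem_singleton_self _)
      obtain ⟨x, rfl⟩ := Finset.card_eq_one.1
        (le_antisymm (Nat.sub_eq_zero_iff_le.1 hA0) hA.card_pos)
      have h := sum_powerset_mem_pow_card y (Finset.mem_univ x)
      rw [Finset.card_univ, Fintype.card_fin, Finset.powerset_univ, Nat.add_sub_cancel] at h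
      have h' : ∑ S : Finset (Fin (m + 1)) with S.Nonempty ∧ {x} ⊆ S, y ^ (S.card - 1) = (y + 1) ^ m := by
        rw [← h]
        refine Finset.sum_congr ?_ fun _ _ => rfl
        ext S
        simp only [Finset.mem_filter, Finset.mem_univ, Finset.singleton_subset_iff,
          true_and, and_iff_right_iff_imp]
        exact fun h => ⟨x, h⟩
      rw [if_neg (Finset.singleton_ne_empty x), h']
      simp only [Finset.singleton_subset_iff, Finset.mem_insert_self, Finset.filter_true,
        sum_powerset_pow_card, hcard]
      ring
    · have hb' : b ∈ univ.erase (1 : Fin (m + 2)) := Finset.mem_erase.2 ⟨hb, Finset.mem_univ _⟩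
      have hA : A = ∅ := by
        rw [← Finset.not_nonempty_iff_eq_empty, hAB, Finset.mem_singleton]
        exact fun h => hb h.symm
      subst hA
      have h1 := sum_powerset_mem_pow_card y hb'
      have h2 := sum_powerset_mem_pow_card' y hb'
      have h3 := mul_sum_powerset_nonempty y (univ : Finset (Fin (m + 1)))
      have h4 : ∀ S : Finset (Fin (m + 2)), S.Nonempty ∧ b ∈ S ↔ b ∈ S := fun S =>
        and_iff_right_of_imp fun h => ⟨b, h⟩
      rw [hcard, Nat.add_sub_cancel] at h1 h2
      rw [Finset.card_univ, Fintype.card_fin, Finset.powerset_univ] at h3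
      simp only [if_true, Finset.singleton_subset_iff, Finset.mem_insert, hb, false_or,
        Finset.empty_subset, and_true, h4, h1, h2]
      -- The sets `B` without `1` give `(y + 1) ^ m`. Those with `1` give `(y + 1) ^ m` times `y`
      -- times the sum over nonempty `A`, which is `(y + 1) ^ (m + 1) - 1`.
      rw [pow_add, ← h3]
      ring
  refine hlhs.trans ?_
  rw [sum_patternRank_eq y (fun k S => S.Nonempty ∧ f k ⊆ S)
    (fun q : Finset (Fin (m + 1)) × Finset (Fin (m + 2)) =>
      (q.2.Nonempty ∧ (q.1.Nonempty ↔ 1 ∈ q.2)) ∧ A ⊆ q.1 ∧ B ⊆ q.2)]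
  have htop : patternRank (topPattern l m).1 = ∑ k : Fin l, ((k : ℕ) + 1) + (m + (m + 1)) := by
    simp [patternRank, topPattern]
  rw [Finset.prod_congr rfl fun k _ => hfk k, Finset.prod_pow_eq_pow_sum, htop, pow_add, ← hpair]

end Counting

/-! ### From a ranked face poset to vertices, edges and the `h`-polynomial -/

section FaceCounting

open Polynomial

variable {E : Type*} [AddCommGroup E] [Module ℝ E] [TopologicalSpace E]
  {C : Set E} {T : Type*} [Fintype T] {rank : T → ℕ}

theorem ncard_faces_eq [PartialOrder T] (e : FacePoset C ≃o T) (P : T → Prop) [DecidablePred P] :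
    {F : Set E | ∃ h : IsFace C F, P (e ⟨F, h⟩)}.ncard = (Finset.univ.filter P).card := by
  have : {F : Set E | ∃ h : IsFace C F, P (e ⟨F, h⟩)} =
      (fun t => (e.symm t : Set E)) '' (Finset.univ.filter P : Finset T) := by
    ext F
    simp only [Set.mem_ofPred_eq, Set.mem_image, Finset.coe_filter, Finset.mem_univ, true_and]
    constructor
    · rintro ⟨h, hP⟩
      exact ⟨_, hP, by simp⟩
    · rintro ⟨t, ht, rfl⟩
      exact ⟨(e.symm t).2, by simpa using ht⟩
  have hinj : Function.Injective fun t => (e.symm t : Set E) :=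
    Subtype.val_injective.comp e.symm.injective
  rw [this, Set.ncard_image_of_injective _ hinj, Set.ncard_coe_finset]

theorem fVector_eq [PartialOrder T] (e : FacePoset C ≃o T)
    (he : ∀ F : FacePoset C, dim (F : Set E) = rank (e F)) (i : ℕ) :
    fVector C i = (Finset.univ.filter fun t => rank t = i).card := by
  rw [← ncard_faces_eq e, fVector]
  congr 1
  ext F
  constructor
  · rintro ⟨h, hF⟩
    exact ⟨h, (he ⟨F, h⟩).symm.trans hF⟩
  · rintro ⟨h, hF⟩
    exact ⟨h, (he ⟨F, h⟩).trans hF⟩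

theorem fPolynomial_eq [Module.Finite ℝ E] [PartialOrder T] (e : FacePoset C ≃o T)
    (he : ∀ F : FacePoset C, dim (F : Set E) = rank (e F)) :
    fPolynomial C = ∑ t, X ^ rank t := by
  have hle : ∀ t ∈ Finset.univ, rank t ∈ Finset.range (dim C + 1) := by
    intro t _
    have h := he (e.symm t)
    rw [OrderIso.apply_symm_apply] at h
    rw [Finset.mem_range, Nat.lt_succ_iff, ← h]
    exact dim_mono (e.symm t).2.2.subset
  rw [fPolynomial, ← Finset.sum_fiberwise_of_maps_to hle]
  refine Finset.sum_congr rfl fun i _ => ?_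
  rw [fVector_eq e he, Finset.sum_congr rfl fun t ht => by rw [(Finset.mem_filter.1 ht).2],
    Finset.sum_const, nsmul_eq_mul]
  simp

theorem hPolynomial_eq [Module.Finite ℝ E] [PartialOrder T] (e : FacePoset C ≃o T)
    (he : ∀ F : FacePoset C, dim (F : Set E) = rank (e F)) :
    hPolynomial C = ∑ t, (X - 1) ^ rank t := by
  rw [hPolynomial, fPolynomial_eq e he]
  simp [Polynomial.sum_comp]

theorem hPolynomial_eval_one (C : Set E) : (hPolynomial C).eval 1 = fVector C 0 := by
  rw [hPolynomial, eval_comp, fPolynomial, eval_finsetSum, Finset.sum_range_succ']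
  simp

theorem ncard_extremePoints_eq [Module.Finite ℝ E]
    (hC : ∀ x, x ∈ C.extremePoints ℝ ↔ IsFace C {x}) :
    (C.extremePoints ℝ).ncard = fVector C 0 := by
  rw [fVector, ← Set.ncard_image_of_injective _ Set.singleton_injective]
  congr 1
  ext F
  constructor
  · rintro ⟨x, hx, rfl⟩
    exact ⟨(hC x).1 hx, dim_singleton x⟩
  · rintro ⟨hF, hd⟩
    obtain ⟨x, hx⟩ := hF.1
    obtain rfl := eq_singleton_of_dim_eq_zero hx hd
    exact ⟨x, (hC x).2 hF, rfl⟩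

/-- The edges through a vertex are the patterns of rank `1` above its pattern. They are counted by
the linear coefficient of `(X + 1) ^ d`, which is `d`, the rank of the top pattern. -/
theorem isSimple_of_pattern {l m : ℕ}
    (hC : ∀ x, x ∈ C.extremePoints ℝ ↔ IsFace C {x}) (e : FacePoset C ≃o Pattern l m)
    (he : ∀ F : FacePoset C, dim (F : Set E) = patternRank (e F).1) : IsSimple C := by
  classical
  intro v hv
  have hface := (hC v).1 hv
  have hrank : patternRank (e ⟨{v}, hface⟩).1 = 0 := (he _).symm.trans (dim_singleton v)
  have hdim : dim C = patternRank (topPattern l m).1 := by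
    have hCC : IsFace C C := ⟨⟨v, hv.1⟩, IsExposed.refl C⟩
    have h : topPattern l m ≤ e ⟨C, hCC⟩ := by
      rw [← e.symm_apply_le]
      exact (e.symm (topPattern l m)).2.2.subset
    rw [← le_antisymm (le_topPattern _) h]
    exact he ⟨C, hCC⟩
  have hset : {F : Set E | IsFace C F ∧ dim F = 1 ∧ v ∈ F} =
      {F : Set E | ∃ h : IsFace C F,
        e ⟨{v}, hface⟩ ≤ e ⟨F, h⟩ ∧ patternRank (e ⟨F, h⟩).1 = 1} := by
    ext F
    simp only [Set.mem_ofPred_eq, ← exists_prop (a := IsFace C F)]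
    refine exists_congr fun h => ?_
    rw [← he, and_comm, e.le_iff_le, ← Subtype.coe_le_coe]
    exact and_congr_left' Set.singleton_subset_iff.symm
  rw [hset, ncard_faces_eq e fun t => e ⟨{v}, hface⟩ ≤ t ∧ patternRank t.1 = 1, hdim]
  have h := congrArg (fun p : ℤ[X] => p.coeff 1)
    (sum_pattern_ge (X : ℤ[X]) (e ⟨{v}, hface⟩) hrank)
  simp only [finsetSum_coeff, coeff_X_pow, coeff_X_add_one_pow, Nat.choose_one_right] at h
  rw [← Finset.filter_filter, Finset.card_filter]
  have h2 : ((∑ t with e ⟨{v}, hface⟩ ≤ t, if patternRank t.1 = 1 then 1 else 0 : ℕ) : ℤ) =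
      (patternRank (topPattern l m).1 : ℤ) := by
    rw [← h]
    push_cast
    exact Finset.sum_congr rfl fun t _ => if_congr eq_comm rfl rfl
  exact_mod_cast h2

end FaceCounting

/-! ### Signatures, `q`-factorials and the conclusion -/

section MainTheorem

/-- For `m ≥ 1` the two signatures differ only in the last entry, on which `IsAdmissible` puts no
condition. -/
theorem isAdmissible_of_signature {m : ℕ} {a : Fin (m + 2) → ℕ}
    (ha : signature a = [1, 0] ++ List.replicate m 1 ∨
      signature a = [1, 0] ++ List.replicate (m - 1) 1 ++ [0]) : IsAdmissible a := by
  have hget : ∀ i : Fin (m + 2), (signature a)[(i : ℕ)]? = some (SignType.sign (a i)) := by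
    intro i
    simp [signature, -List.ofFn_succ]
  have h0 : SignType.sign (a 0) = 1 := by
    have := hget 0
    rcases ha with h | h <;> rw [h] at this <;> simpa using this.symm
  have h1 : SignType.sign (a 1) = 0 := by
    have := hget 1
    rcases ha with h | h <;> rw [h] at this <;> simpa using this.symm
  refine ⟨sign_eq_one_iff.1 h0, sign_eq_zero_iff.1 h1, fun k => sign_eq_one_iff.1 ?_⟩
  have := hget (patternRow k)
  obtain ⟨i, hi⟩ : ∃ i, m - (k : ℕ) = i + 2 := ⟨m - k - 2, by omega⟩
  rw [patternRow_val, hi] at this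
  rcases ha with h | h <;> rw [h] at this
  · simp [show i < m by omega] at this
    exact this.symm
  · simp [List.getElem?_append, show i < m - 1 by omega] at this
    exact this.symm

theorem qFactorial_eq_prod_range (m : ℕ) :
    qFactorial m = ∏ k ∈ Finset.range m, ∑ j ∈ Finset.range (k + 1), Polynomial.X ^ j := by
  rw [qFactorial]
  induction m with
  | zero => simp
  | succ m ih => rw [Finset.prod_Icc_succ_top (by omega), Finset.prod_range_succ, ih]

/-- The factor for `i = 1` is `1`; the simplices `Δ_1, …, Δ_{m-1}` account for `i = 2, …, m`, and
`P` supplies `i = m + 1`. -/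
theorem qFactorial_succ (m : ℕ) :
    qFactorial (m + 1) = (∏ k : Fin (m - 1), ∑ j ∈ Finset.range ((k : ℕ) + 2), Polynomial.X ^ j) *
      ∑ j ∈ Finset.range (m + 1), Polynomial.X ^ j := by
  rw [qFactorial_eq_prod_range, Finset.prod_range_succ]
  congr 1
  rw [Fin.prod_univ_eq_prod_range
    (fun k => ∑ j ∈ Finset.range (k + 2), (Polynomial.X : Polynomial ℤ) ^ j)]
  rcases m with _ | m
  · simp
  · rw [Finset.prod_range_succ']
    simp

theorem qFactorial_eval_one (m : ℕ) : (qFactorial m).eval 1 = m.factorial := by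
  rw [qFactorial_eq_prod_range, Polynomial.eval_prod, ← Finset.prod_range_add_one_eq_factorial,
    Nat.cast_prod]
  simp [Polynomial.eval_finsetSum]

end MainTheorem

end Tesler

theorem mainTheorem8 (n : ℕ) (a : Fin n → ℕ)
    (ha : Tesler.signature a = [1, 0] ++ List.replicate (n - 2) 1 ∨
      Tesler.signature a = [1, 0] ++ List.replicate (n - 3) 1 ++ [0]) :
    Nonempty (Tesler.FacePoset (Tesler.Tes a) ≃o
      Tesler.ProductFacePoset (Tesler.simplexProduct (n - 3)) (n - 2)) ∧
    ((Tesler.Tes a).extremePoints ℝ).ncard = 2 * (n - 1).factorial ∧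
    Tesler.IsSimple (Tesler.Tes a) ∧
    Tesler.hPolynomial (Tesler.Tes a) =
      (1 + Polynomial.X ^ (n - 1)) * Tesler.qFactorial (n - 1) := by
  classical
  -- The length of the signature word already forces `n ≥ 2`.
  obtain ⟨m, rfl⟩ : ∃ m, n = m + 2 := by
    refine ⟨n - 2, ?_⟩
    rcases ha with h | h <;>
    · have := congrArg List.length h
      simp [Tesler.signature] at this
      omega
  have hadm : Tesler.IsAdmissible a := Tesler.isAdmissible_of_signature ha
  let e : Tesler.FacePoset (Tesler.Tes a) ≃o Tesler.Pattern (m - 1) m :=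
    (Tesler.teslerFaceIso a).symm.trans (Tesler.supportPatternIso hadm)
  have he : ∀ F : Tesler.FacePoset (Tesler.Tes a),
      Tesler.dim (F : Set (Matrix (Fin (m + 2)) (Fin (m + 2)) ℝ)) =
        Tesler.patternRank (e F).1 := by
    intro F
    obtain ⟨S, rfl⟩ := (Tesler.teslerFaceIso a).surjective F
    rw [Tesler.dim_teslerFaceIso, ← Tesler.patternRank_rowsPattern S.2.1]
    simp only [e, OrderIso.trans_apply, OrderIso.symm_apply_apply]
    rfl
  have hext := fun x => Tesler.mem_extremePoints_iff_isFace_singleton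
    (Tesler.isCoordPolyhedron_Tes a) (x := x)
  have hh : Tesler.hPolynomial (Tesler.Tes a) =
      (1 + Polynomial.X ^ (m + 1)) * Tesler.qFactorial (m + 1) := by
    rw [Tesler.hPolynomial_eq (rank := fun t => Tesler.patternRank t.1) e he, Tesler.sum_pattern_X_sub_one, Tesler.qFactorial_succ]
    ring
  refine ⟨⟨e.trans (Tesler.patternFaceIso (m - 1) m)⟩, ?_,
    Tesler.isSimple_of_pattern hext e he, hh⟩
  -- At `x = 1` the `h`-polynomial is `f_0`, and the product formula becomes `2 * (m + 1)!`.
  have h := Tesler.hPolynomial_eval_one (Tesler.Tes a)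
  rw [hh, Polynomial.eval_mul, Tesler.qFactorial_eval_one,
    ← Tesler.ncard_extremePoints_eq hext] at h
  have h2 : (((Tesler.Tes a).extremePoints ℝ).ncard : ℤ) = 2 * ((m + 1).factorial : ℤ) := by
    rw [← h]
    simp
  exact_mod_cast h2
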